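/- **Setting.** Let $\Omega\subseteq\mathbb R^n$ be open and *thick*, i.e. there are $c,\epsilon_1>0$ with $|B_\epsilon(x)\cap\Omega|>c\,|B_\epsilon(x)|$ for all $\epsilon\in(0,\epsilon_1)$ and $x\in\Omega$, where $|\cdot|$ is Lebesgue measure. Let $h:\mathbb R^n\to\mathbb R$ be in $L^1(\mathbb R^n)$ with $h\ge 0$, $\|h\|_{L^1(\mathbb R^n)}=1$, $h(Ox)=h(x)$ for all $x\in\mathbb R^n$ and all orthogonal matrices $O$, and $h(y)\le h(x)$ whenever $\|x\|\le\|y\|$. For $\epsilon>0$ put $k_\epsilon(x,y)=\epsilon^{-n}h((y-x)/\epsilon)$, $$d_\epsilon(x)=\int_\Omega k_\epsilon(x,y)\,dy,\qquad q_\epsilon(x)=\int_\Omega\frac{k_\epsilon(x,y)}{d_\epsilon(y)}\,dy,$$ $$\tilde p_\epsilon(x,y)=\int_\Omega\frac{k_\epsilon(x,z)\,k_\epsilon(z,y)}{d_\epsilon(x)\,q_\epsilon(z)\,d_\epsilon(y)}\,dz,\qquad \tilde P_\epsilon f(x)=\int_\Omega\tilde p_\epsilon(x,y)f(y)\,dy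 .$$ **Theorem.** There exists $\epsilon_0>0$ such that for all $\epsilon\in(0,\epsilon_0)$ and $x,y\in\Omega$ we have $d_\epsilon(x)>0$, $q_\epsilon(x)>0$, and the integral defining $\tilde p_\epsilon(x,y)$ converges absolutely, and such that for every $p\in[1,\infty]$, $\{\tilde P_\epsilon\}_{0<\epsilon<\epsilon_0}$ is a well-defined and uniformly bounded family of operators from $L^p(\Omega)$ to itself: for every $f\in L^p(\Omega)$ and $\epsilon\in(0,\epsilon_0)$ the integral defining $\tilde P_\epsilon f(x)$ converges absolutely for every $x\in\Omega$, and $\|\tilde P_\epsilon f\|_{L^p(\Omega)}\le A\|f\|_{L^p(\Omega)}$ with $A<\infty$ independent of $f$ and of $\epsilon$. If, in addition, $\Omega$ is bounded and there are $C,\delta>0$ with $|h(x)|\le C(1+\|x\|)^{-(n+\delta)}$ for all $x\in\mathbb R^n$, then the following hold. 1. For every $p\in(1,\infty)$ and $f\in L^p(\Omega)$, $\tilde P_\epsilon f\to f$ in $L^p(\Omega)$ norm as $\epsilon\to0^+$. 2. For every $p\in(1,\infty]$ and $q\in[1,\infty)$ with $\frac1p+\frac1q=1$: if $h\in L^q(\mathbb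 R^n)$, then for every $f\in L^p(\Omega)$ and $\epsilon\in(0,\epsilon_0)$, $\tilde P_\epsilon f$ is continuous and bounded on $\Omega$. 3. For every $r\in\{0,1,2,\dots\}$: if $h\in H^r(\mathbb R^n)$, i.e. $h\in L^2(\mathbb R^n)$ and its $L^2$ Fourier transform $\hat h$ satisfies $\int_{\mathbb R^n}|\hat h(\omega)|^2(1+\|\omega\|^2)^r\,d\omega<\infty$, then for every $f\in L^2(\Omega)$ and $\epsilon\in(0,\epsilon_0)$, $\tilde P_\epsilon f\in C^r(\Omega)$. -/

import Mathlib

open MeasureTheory Set Filter Topology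
open scoped ENNReal NNReal FourierTransform

noncomputable section

/-- A Lebesgue-measurable set `Ω ⊆ ℝⁿ` is thick if there are `c, ε₀ > 0` with
`|B_ε(x) ∩ Ω| > c |B_ε(x)|` for all `ε ∈ (0, ε₀)` and `x ∈ Ω`. -/
def IsThick {n : ℕ} (Ω : Set (EuclideanSpace ℝ (Fin n))) : Prop :=
  NullMeasurableSet Ω volume ∧
    ∃ c > (0 : ℝ), ∃ ε₀ > (0 : ℝ), ∀ ε ∈ Ioo 0 ε₀, ∀ x ∈ Ω,
      ENNReal.ofReal c * volume (Metric.ball x ε) < volume (Metric.ball x ε ∩ Ω)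

/-- A shape function: a non-negative, orthogonally invariant `h ∈ L¹(ℝⁿ)` with `‖h‖_{L¹} = 1`. -/
structure IsShapeFunction {n : ℕ} (h : EuclideanSpace ℝ (Fin n) → ℝ) : Prop where
  integrable : Integrable h volume
  nonneg : ∀ x, 0 ≤ h x
  orthogonal_invariant : ∀ O ∈ Matrix.orthogonalGroup (Fin n) ℝ, ∀ x,
    h (Matrix.toEuclideanLin O x) = h x
  norm_one : ∫ x, ‖h x‖ = 1

/-- `h` is radially decreasing (in the weak sense). -/
def IsRadiallyDecreasing {n : ℕ} (h : EuclideanSpace ℝ (Fin n) → ℝ) : Prop :=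
  ∀ x y, ‖x‖ ≤ ‖y‖ → h y ≤ h x

/-- The decay bound `|h(x)| ≤ C (1 + ‖x‖)^{-(n+δ)}` for some `C, δ > 0`. -/
def HasDecayBound {n : ℕ} (h : EuclideanSpace ℝ (Fin n) → ℝ) : Prop :=
  ∃ C > (0 : ℝ), ∃ δ > (0 : ℝ), ∀ x, |h x| ≤ C * (1 + ‖x‖) ^ (-((n : ℝ) + δ))

/-- The rescaled shape function `h_ε(x) = ε⁻ⁿ h(x / ε)`. -/
def scaledShape {n : ℕ} (h : EuclideanSpace ℝ (Fin n) → ℝ) (ε : ℝ)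
    (x : EuclideanSpace ℝ (Fin n)) : ℝ :=
  (ε ^ n)⁻¹ * h (ε⁻¹ • x)

/-- The radial kernel `k_ε(x, y) = h_ε(y - x)`. -/
def radialKernel {n : ℕ} (h : EuclideanSpace ℝ (Fin n) → ℝ) (ε : ℝ)
    (x y : EuclideanSpace ℝ (Fin n)) : ℝ :=
  scaledShape h ε (y - x)

/-- The convolution operator `K_ε f (x) = ∫_{ℝⁿ} k_ε(x, y) f(y) dy`. -/
def smoothingOp {n : ℕ} (h : EuclideanSpace ℝ (Fin n) → ℝ) (ε : ℝ)
    (f : EuclideanSpace ℝ (Fin n) → ℝ) (x : EuclideanSpace ℝ (Fin n)) : ℝ :=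
  ∫ y, radialKernel h ε x y * f y

/-- The degree function `d_ε = K_ε 1_Ω`. -/
def degreeFn {n : ℕ} (Ω : Set (EuclideanSpace ℝ (Fin n)))
    (h : EuclideanSpace ℝ (Fin n) → ℝ) (ε : ℝ) : EuclideanSpace ℝ (Fin n) → ℝ :=
  smoothingOp h ε (Ω.indicator fun _ => 1)

/-- The normalization function `q_ε = K_ε (1_Ω / d_ε)`. -/
def normalizationFn {n : ℕ} (Ω : Set (EuclideanSpace ℝ (Fin n)))
    (h : EuclideanSpace ℝ (Fin n) → ℝ) (ε : ℝ) : EuclideanSpace ℝ (Fin n) → ℝ :=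
  smoothingOp h ε (Ω.indicator fun y => 1 / degreeFn Ω h ε y)

/-- The integrand `k_ε(x, z) k_ε(z, y) / (d_ε(x) q_ε(z) d_ε(y))` of the bistochastic kernel, as a
function of `z`. -/
def bistochIntegrand {n : ℕ} (Ω : Set (EuclideanSpace ℝ (Fin n)))
    (h : EuclideanSpace ℝ (Fin n) → ℝ) (ε : ℝ) (x y z : EuclideanSpace ℝ (Fin n)) : ℝ :=
  radialKernel h ε x z * radialKernel h ε z y /
    (degreeFn Ω h ε x * normalizationFn Ω h ε z * degreeFn Ω h ε y)

/-- The bistochastic kernel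
`p̃_ε(x, y) = ∫_Ω k_ε(x, z) k_ε(z, y) / (d_ε(x) q_ε(z) d_ε(y)) dz`. -/
def bistochKernel {n : ℕ} (Ω : Set (EuclideanSpace ℝ (Fin n)))
    (h : EuclideanSpace ℝ (Fin n) → ℝ) (ε : ℝ) (x y : EuclideanSpace ℝ (Fin n)) : ℝ :=
  ∫ z in Ω, bistochIntegrand Ω h ε x y z

/-- The bistochastic operator `P̃_ε f (x) = ∫_Ω p̃_ε(x, y) f(y) dy`. -/
def bistochOp {n : ℕ} (Ω : Set (EuclideanSpace ℝ (Fin n)))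
    (h : EuclideanSpace ℝ (Fin n) → ℝ) (ε : ℝ) (f : EuclideanSpace ℝ (Fin n) → ℝ)
    (x : EuclideanSpace ℝ (Fin n)) : ℝ :=
  ∫ y in Ω, bistochKernel Ω h ε x y * f y

/-- `h ∈ H^r(ℝⁿ)`: `h` is in `L²(ℝⁿ)` and its unitary (`L²`) Fourier transform `ĥ` satisfies
`∫ |ĥ(ω)|² (1 + ‖ω‖²)^r dω < ∞`. Mathlib's transform is normalized with `exp(-2πi ω·x)`;
replacing it by `exp(-i ω·x)` rescales `ω` and gives the same space. -/
def MemSobolevH {n : ℕ} (r : ℝ) (h : EuclideanSpace ℝ (Fin n) → ℝ) : Prop :=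
  ∃ hh : MemLp (fun x => (h x : ℂ)) 2 (volume : Measure (EuclideanSpace ℝ (Fin n))),
    MemLp (fun ω => (1 + ‖ω‖ ^ 2) ^ (r / 2) * ‖(𝓕 (hh.toLp fun x => (h x : ℂ))) ω‖) 2
      (volume : Measure (EuclideanSpace ℝ (Fin n)))

/-- `g ∈ C_b(Ω)`: `g` is continuous and bounded on `Ω`. -/
def MemCb {n : ℕ} (Ω : Set (EuclideanSpace ℝ (Fin n)))
    (g : EuclideanSpace ℝ (Fin n) → ℝ) : Prop :=
  ContinuousOn g Ω ∧ ∃ M : ℝ, ∀ x ∈ Ω, |g x| ≤ M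

end

/-! Monotonicity makes `h` radial, bounded by `h 0`, and bounded below by a positive constant on a
ball. Thickness turns this into d_ε ≥ α > 0 on Ω for all small ε (`exists_le_degreeFn`); since d_ε ≤
1, also q_ε ≥ d_ε ≥ α on Ω.

The kernel p̃_ε is nonnegative and symmetric. Integrating it in y first produces q_ε(z), which
cancels, and what remains is k_ε(x,·)/d_ε(x), of mass one. So p̃_ε is doubly stochastic, and Schur's
test makes P̃_ε a contraction on every L^p(Ω).

When Ω has finite measure, Fubini gives P̃_ε f = d_ε⁻¹ · K_ε w with w = 1_Ω q_ε⁻¹ K_ε(1_Ω f/d_ε)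
bounded and integrable (`bistochOp_eq`). As d_ε = K_ε 1_Ω has the same form, regularity reduces to
correlations of `h` with bounded integrable w. These are continuous by L¹ approximation. If h ∈ H^r,
the transform of the correlation is a product of L² functions, one of them carrying the weight
(1+‖ω‖²)^{r/2}, hence is integrable against that weight, and Fourier inversion gives C^r.

For convergence, contraction and density reduce to continuous bounded g. Put ψ = |g − g(x)|. The
Markov property and the lower bounds give |P̃_ε g(x) − g(x)| ≤ P̃_ε ψ(x) ≤ α⁻³ K_ε K_ε ψ(x) → α⁻³
ψ(x) = 0, with K_ε acting on all of ℝⁿ. The limits of d_ε and q_ε are never needed. Dominated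
convergence finishes. -/

/-! ### Regularity of correlations, by approximation and by Fourier inversion. -/

section FourierAnalysis

variable {V : Type*} [NormedAddCommGroup V] [InnerProductSpace ℝ V] [FiniteDimensional ℝ V]
  [MeasurableSpace V] [BorelSpace V]

open scoped Convolution SchwartzMap in
/-- On `L¹ ∩ L²` the `L²` Fourier transform is almost everywhere the Fourier integral. -/
theorem fourier_toLp_ae_eq {f : V → ℂ} (hf : Integrable f) (hf2 : MemLp f 2) :
    (𝓕 (hf2.toLp f) : Lp ℂ 2 (volume : Measure V)) =ᵐ[volume] 𝓕 f := by
  have hcont : Continuous (𝓕 f) :=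
    VectorFourier.fourierIntegral_continuous Real.continuous_fourierChar
      (by exact continuous_inner) hf
  -- Both sides pair with a smooth compactly supported φ to give ∫ φ̂ f: the L² transform by its
  -- compatibility with tempered distributions, the Fourier integral by Fubini.
  apply ae_eq_of_integral_contDiff_smul_eq
  · exact (Lp.memLp _).locallyIntegrable (by norm_num)
  · exact hcont.locallyIntegrable
  · intro g g_smooth g_cpt
    have hg₁ : HasCompactSupport (Complex.ofRealCLM ∘ g) := g_cpt.comp_left rfl
    have hg₂ : ContDiff ℝ ((⊤ : ℕ∞) : WithTop ℕ∞) (Complex.ofRealCLM ∘ g) :=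
      Complex.ofRealCLM.contDiff.comp g_smooth
    set φ : 𝓢(V, ℂ) := hg₁.toSchwartzMap hg₂ with hφ
    have h1 := congrArg (fun T : 𝓢'(V, ℂ) => T φ)
      (Lp.fourier_toTemperedDistribution_eq (hf2.toLp f))
    simp only [TemperedDistribution.fourier_apply, Lp.toTemperedDistribution_apply] at h1
    have h2 : ∫ x, g x • (𝓕 (hf2.toLp f) : Lp ℂ 2 (volume : Measure V)) x
        = ∫ x, φ x • (𝓕 (hf2.toLp f) : Lp ℂ 2 (volume : Measure V)) x := by
      simp [hφ]
    rw [h2, ← h1]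
    have h3 : ∫ x, (𝓕 φ) x • (hf2.toLp f) x = ∫ x, 𝓕 (φ : V → ℂ) x • f x := by
      apply integral_congr_ae
      filter_upwards [hf2.coeFn_toLp] with x hx
      rw [hx, SchwartzMap.fourier_coe]
    rw [h3]
    have h4 := VectorFourier.integral_fourierIntegral_smul_eq_flip (μ := (volume : Measure V))
      (ν := (volume : Measure V)) (L := innerₗ V)
      Real.continuous_fourierChar (by exact continuous_inner) φ.integrable hf
    rw [flip_innerₗ] at h4
    refine h4.trans ?_
    simp [hφ]
    rfl

/-- For integrable `f` and bounded measurable `G`, the correlation of `f` and `G` is continuous. -/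
theorem continuous_integral_sub_mul {f G : V → ℝ} (hf : Integrable f)
    (hG : AEStronglyMeasurable G) {M : ℝ} (hM : ∀ y, |G y| ≤ M) :
    Continuous fun x => ∫ y, f (y - x) * G y := by
  have hM0 : 0 ≤ M := (abs_nonneg _).trans (hM 0)
  have hint : ∀ u : V → ℝ, Integrable u → ∀ x, Integrable fun y => u (y - x) * G y := fun u hu x =>
    (hu.comp_sub_right x).mul_bdd (c := M) hG (Eventually.of_forall hM)
  refine continuous_of_uniform_approx_of_continuous (f := fun x => ∫ y, f (y - x) * G y) ?_
  intro U hU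
  obtain ⟨δ, hδ, hδU⟩ := Metric.mem_uniformity_dist.1 hU
  -- Replacing `f` by `g` changes the correlation by at most M‖f − g‖₁, uniformly in x. The `+ 1`
  -- keeps the tolerance meaningful when `M = 0`.
  obtain ⟨g, hgc, hgf, hgcont, hgint⟩ := hf.exists_hasCompactSupport_integral_sub_le
    (ε := δ / (2 * (M + 1))) (by positivity)
  refine ⟨fun x => ∫ y, g (y - x) * G y, ?_, fun x => hδU ?_⟩
  · have hg' : HasCompactSupport fun x => g (-x) := hgc.comp_homeomorph (Homeomorph.neg V)
    have hGloc : LocallyIntegrable G :=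
      (memLp_top_of_bound hG M (Eventually.of_forall hM)).locallyIntegrable le_top
    have := hg'.continuous_convolution_right (ContinuousLinearMap.mul ℝ ℝ) hGloc
      (hgcont.comp continuous_neg)
    convert this using 2 with x
    simp [convolution_def, mul_comm]
  · rw [dist_eq_norm, ← integral_sub (hint f hf x) (hint g hgint x)]
    calc ‖∫ y, (f (y - x) * G y - g (y - x) * G y)‖
        ≤ ∫ y, ‖f (y - x) - g (y - x)‖ * M := by
          refine norm_integral_le_of_norm_le
            (((hf.sub hgint).comp_sub_right x).norm.mul_const M) (Eventually.of_forall fun y => ?_)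
          rw [← sub_mul, norm_mul]
          exact mul_le_mul_of_nonneg_left (hM y) (norm_nonneg _)
      _ = (∫ y, ‖f y - g y‖) * M := by
          rw [integral_mul_const, integral_sub_right_eq_self (fun y => ‖f y - g y‖) x]
      _ ≤ δ / (2 * (M + 1)) * M := by gcongr
      _ < δ := by
          rw [div_mul_eq_mul_div, div_lt_iff₀ (by positivity)]
          nlinarith

/-- If `f` lies in the Sobolev space `H^r`, its correlation with a square integrable `w` is
`C^r`. -/
theorem contDiff_integral_sub_mul {f w : V → ℝ} (hf : Integrable f) (hf_even : ∀ x, f (-x) = f x)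
    (hf2 : MemLp (fun x => (f x : ℂ)) 2) (hw : Integrable w) {M : ℝ} (hM : ∀ y, |w y| ≤ M)
    (hw2 : MemLp (fun x => (w x : ℂ)) 2) (r : ℕ)
    (hfr : MemLp (fun ω => (1 + ‖ω‖ ^ 2) ^ ((r : ℝ) / 2) *
      ‖(𝓕 (hf2.toLp fun x => (f x : ℂ)) : Lp ℂ 2 (volume : Measure V)) ω‖) 2) :
    ContDiff ℝ r fun x => ∫ y, f (y - x) * w y := by
  set F : V → ℂ := fun x => (f x : ℂ) with hF
  set W : V → ℂ := fun x => (w x : ℂ) with hW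
  have hFi : Integrable F := hf.ofReal
  have hWi : Integrable W := hw.ofReal
  set H : V → ℝ := fun x => ∫ y, f (y - x) * w y with hH
  -- Evenness of `f` turns the correlation into a convolution, whose transform is a product.
  set C : V → ℂ := convolution W F (ContinuousLinearMap.mul ℂ ℂ) volume with hC
  have hCH : C = fun x => (H x : ℂ) := by
    ext x
    rw [hC, hH, convolution_def, ← integral_complex_ofReal]
    refine integral_congr_ae (Eventually.of_forall fun t => ?_)
    have : f (x - t) = f (t - x) := by rw [← hf_even, neg_sub]
    simp [hF, hW, this, mul_comm]
  have hCcont : Continuous C := by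
    rw [hCH]
    exact Complex.continuous_ofReal.comp
      (continuous_integral_sub_mul hf hw.aestronglyMeasurable hM)
  have hCint : Integrable C := hWi.integrable_convolution _ hFi
  have hCF : ∀ ξ, 𝓕 C ξ = 𝓕 W ξ * 𝓕 F ξ := Real.fourier_mul_convolution_eq hWi hFi
  have hFW : AEStronglyMeasurable (𝓕 C) :=
    (VectorFourier.fourierIntegral_continuous Real.continuous_fourierChar
      (by exact continuous_inner) hCint : Continuous (𝓕 C)).aestronglyMeasurable
  -- Cauchy–Schwarz for the weighted L² transform of `f` and the L² transform of `w`, which agree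
  -- almost everywhere with the Fourier integrals.
  have hprod : Integrable fun ω => ((1 + ‖ω‖ ^ 2) ^ ((r : ℝ) / 2)) * ‖𝓕 C ω‖ := by
    have h1 := MemLp.integrable_mul hfr (Lp.memLp (𝓕 (hw2.toLp W))).norm
    refine h1.congr ?_
    filter_upwards [fourier_toLp_ae_eq hFi hf2, fourier_toLp_ae_eq hWi hw2] with ω h2 h3
    change (1 + ‖ω‖ ^ 2) ^ ((r : ℝ) / 2) * ‖(𝓕 (hf2.toLp F) : Lp ℂ 2 (volume : Measure V)) ω‖ *
      ‖(𝓕 (hw2.toLp W) : Lp ℂ 2 (volume : Measure V)) ω‖ = _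
    rw [h2, h3, hCF, norm_mul]
    ring
  have hpow : ∀ k : ℕ, (k : ℕ∞) ≤ r → Integrable fun ω => ‖ω‖ ^ k * ‖𝓕 C ω‖ := by
    intro k hk
    have hk' : k ≤ r := by exact_mod_cast hk
    refine hprod.mono' ((continuous_norm.pow k).aestronglyMeasurable.mul hFW.norm)
      (Eventually.of_forall fun ω => ?_)
    rw [norm_mul, norm_norm, norm_pow, norm_norm]
    refine mul_le_mul_of_nonneg_right ?_ (norm_nonneg _)
    have hbase : ‖ω‖ ≤ (1 + ‖ω‖ ^ 2) ^ ((1 : ℝ) / 2) := by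
      rw [← Real.sqrt_eq_rpow]
      exact Real.le_sqrt_of_sq_le (by linarith)
    calc ‖ω‖ ^ k ≤ ((1 + ‖ω‖ ^ 2) ^ ((1 : ℝ) / 2)) ^ k := by gcongr
      _ = (1 + ‖ω‖ ^ 2) ^ ((k : ℝ) / 2) := by
          rw [← Real.rpow_natCast, ← Real.rpow_mul (by positivity)]; ring_nf
      _ ≤ (1 + ‖ω‖ ^ 2) ^ ((r : ℝ) / 2) := by
          refine Real.rpow_le_rpow_of_exponent_le (by nlinarith [sq_nonneg ‖ω‖]) ?_
          have : (k : ℝ) ≤ r := by exact_mod_cast hk'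
          linarith
  have hFC : Integrable (𝓕 C) := by
    have := hpow 0 (by simp)
    simp only [pow_zero, one_mul] at this
    exact (integrable_norm_iff hFW).1 this
  -- Continuity of `C` makes inversion hold at every point. Thus `C` is a reflected Fourier
  -- transform of a function with integrable moments up to order `r`.
  have hinv : 𝓕⁻ (𝓕 C) = C := hCcont.fourierInv_fourier_eq hCint hFC
  have hCD : ContDiff ℝ r C := by
    rw [← hinv]
    have h1 : ContDiff ℝ ((r : ℕ∞) : WithTop ℕ∞) (𝓕 (𝓕 C)) := Real.contDiff_fourier hpow
    have h2 : 𝓕⁻ (𝓕 C) = fun x => 𝓕 (𝓕 C) (-x) := by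
      ext x
      rw [Real.fourierInv_eq_fourier_neg]
    rw [h2]
    exact h1.comp contDiff_neg
  have : H = fun x => Complex.reCLM (C x) := by
    ext x; simp [hCH]
  rw [this]
  exact Complex.reCLM.contDiff.comp hCD

end FourierAnalysis

/-! ### The rescaled kernel and the lower bound on the degree. -/

section KernelEstimates

variable {n : ℕ} {Ω : Set (EuclideanSpace ℝ (Fin n))} {h : EuclideanSpace ℝ (Fin n) → ℝ}
  {ε α : ℝ}

theorem IsRadiallyDecreasing.eq_of_norm_eq (hd : IsRadiallyDecreasing h)
    {x y : EuclideanSpace ℝ (Fin n)} (hxy : ‖x‖ = ‖y‖) : h x = h y :=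
  le_antisymm (hd _ _ hxy.ge) (hd _ _ hxy.le)

theorem IsRadiallyDecreasing.neg (hd : IsRadiallyDecreasing h) (x : EuclideanSpace ℝ (Fin n)) :
    h (-x) = h x :=
  hd.eq_of_norm_eq (norm_neg x)

theorem IsRadiallyDecreasing.le_zero (hd : IsRadiallyDecreasing h)
    (x : EuclideanSpace ℝ (Fin n)) : h x ≤ h 0 :=
  hd _ _ (by simp)

/-- Each superlevel set is the preimage under the norm of a downward closed, hence measurable, set
of reals. -/
theorem IsRadiallyDecreasing.measurable (hd : IsRadiallyDecreasing h) : Measurable h := by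
  refine measurable_of_Ioi fun t => ?_
  set D : Set ℝ := {s | ∃ x, t < h x ∧ s ≤ ‖x‖} with hD
  have hDm : MeasurableSet D := by
    refine OrdConnected.measurableSet ⟨?_⟩
    rintro a - b ⟨x, hx, hb⟩ c hc
    exact ⟨x, hx, hc.2.trans hb⟩
  have : h ⁻¹' Ioi t = (fun x => ‖x‖) ⁻¹' D := by
    ext x
    constructor
    · intro hx
      exact ⟨x, hx, le_rfl⟩
    · rintro ⟨y, hy, hxy⟩
      exact lt_of_lt_of_le hy (hd _ _ hxy)
  rw [this]
  exact measurable_norm hDm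

theorem IsShapeFunction.integral_eq_one (hs : IsShapeFunction h) : ∫ x, h x = 1 := by
  rw [← hs.norm_one]
  exact integral_congr_ae (Eventually.of_forall fun x => (Real.norm_of_nonneg (hs.nonneg x)).symm)

/-- A radially decreasing shape function is bounded below on some ball. -/
theorem IsShapeFunction.exists_ball_le (hs : IsShapeFunction h) (hd : IsRadiallyDecreasing h) :
    ∃ r > (0 : ℝ), ∃ m > (0 : ℝ), ∀ x, ‖x‖ < r → m ≤ h x := by
  by_cases hx : ∃ x, x ≠ 0 ∧ h x ≠ 0
  · obtain ⟨x, hx0, hx⟩ := hx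
    exact ⟨‖x‖, norm_pos_iff.2 hx0, h x, lt_of_le_of_ne (hs.nonneg x) hx.symm,
      fun y hy => hd _ _ hy.le⟩
  · push Not at hx
    have hone := hs.integral_eq_one
    -- Here `h` vanishes off the origin. For n = 0 the origin is the whole space and must carry the
    -- integral; for n > 0 it is null and the integral would be zero.
    rcases subsingleton_or_nontrivial (EuclideanSpace ℝ (Fin n)) with hE | hE
    · refine ⟨1, one_pos, h 0, lt_of_le_of_ne (hs.nonneg 0) fun h0 => ?_, fun x _ => ?_⟩
      · have : h = 0 := by ext x; rw [Subsingleton.elim x 0, ← h0]; rfl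
        simp [this] at hone
      · rw [Subsingleton.elim x 0]
    · exfalso
      have h0 : h =ᵐ[volume] 0 := by
        have : ∀ᵐ x : EuclideanSpace ℝ (Fin n), x ≠ 0 := by
          simp [ae_iff, measure_singleton]
        filter_upwards [this] with x hx0 using hx x hx0
      rw [integral_congr_ae h0] at hone
      simp at hone

theorem radialKernel_nonneg (hs : IsShapeFunction h) (hε : 0 < ε)
    (x y : EuclideanSpace ℝ (Fin n)) : 0 ≤ radialKernel h ε x y :=
  mul_nonneg (by positivity) (hs.nonneg _)

theorem radialKernel_comm (hd : IsRadiallyDecreasing h) (x y : EuclideanSpace ℝ (Fin n)) :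
    radialKernel h ε x y = radialKernel h ε y x := by
  unfold radialKernel scaledShape
  rw [← neg_sub x y, smul_neg, hd.neg]

theorem radialKernel_le (hd : IsRadiallyDecreasing h) (hε : 0 < ε)
    (x y : EuclideanSpace ℝ (Fin n)) : radialKernel h ε x y ≤ (ε ^ n)⁻¹ * h 0 :=
  mul_le_mul_of_nonneg_left (hd.le_zero _) (by positivity)

theorem measurable_scaledShape (hd : IsRadiallyDecreasing h) : Measurable (scaledShape h ε) :=
  (hd.measurable.comp (measurable_const_smul _)).const_mul _

theorem measurable_radialKernel (hd : IsRadiallyDecreasing h) :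
    Measurable (Function.uncurry (radialKernel h ε)) :=
  (measurable_scaledShape hd).comp (measurable_snd.sub measurable_fst)

/-- Integration against the rescaled kernel is averaging over rescaled displacements. -/
theorem integral_radialKernel_mul (hε : 0 < ε) (φ : EuclideanSpace ℝ (Fin n) → ℝ)
    (x : EuclideanSpace ℝ (Fin n)) :
    ∫ y, radialKernel h ε x y * φ y = ∫ u, h u * φ (x + ε • u) := by
  have h1 := integral_add_right_eq_self (μ := volume)
    (fun y => radialKernel h ε x y * φ y) x
  have h2 := Measure.integral_comp_smul (volume : Measure (EuclideanSpace ℝ (Fin n)))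
    (fun y => radialKernel h ε x (y + x) * φ (y + x)) ε
  rw [h1] at h2
  have hpos : 0 < ε ^ n := by positivity
  rw [finrank_euclideanSpace_fin, abs_of_pos (inv_pos.2 hpos), smul_eq_mul] at h2
  have h3 : ∫ y, radialKernel h ε x y * φ y = ε ^ n *
      ∫ u, radialKernel h ε x (ε • u + x) * φ (ε • u + x) := by
    rw [h2]; field_simp
  rw [h3, ← integral_const_mul]
  refine integral_congr_ae (Eventually.of_forall fun u => ?_)
  simp only [radialKernel, scaledShape, add_sub_cancel_right, smul_smul, inv_mul_cancel₀ hε.ne',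
    one_smul, add_comm x]
  field_simp

theorem integrable_scaledShape (hs : IsShapeFunction h) (hε : 0 < ε) :
    Integrable (scaledShape h ε) :=
  (hs.integrable.comp_smul (inv_ne_zero hε.ne')).const_mul _

theorem integrable_radialKernel (hs : IsShapeFunction h) (hε : 0 < ε)
    (x : EuclideanSpace ℝ (Fin n)) : Integrable (radialKernel h ε x) :=
  (integrable_scaledShape hs hε).comp_sub_right x

theorem integral_radialKernel (hs : IsShapeFunction h) (hε : 0 < ε)
    (x : EuclideanSpace ℝ (Fin n)) : ∫ y, radialKernel h ε x y = 1 := by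
  have := integral_radialKernel_mul (h := h) hε (fun _ => 1) x
  simpa [hs.integral_eq_one] using this

theorem smoothingOp_indicator (hΩ : MeasurableSet Ω) (φ : EuclideanSpace ℝ (Fin n) → ℝ)
    (x : EuclideanSpace ℝ (Fin n)) :
    smoothingOp h ε (Ω.indicator φ) x = ∫ y in Ω, radialKernel h ε x y * φ y := by
  rw [smoothingOp, ← integral_indicator hΩ]
  refine integral_congr_ae (Eventually.of_forall fun y => ?_)
  by_cases hy : y ∈ Ω <;> simp [hy]

theorem degreeFn_eq (hΩ : MeasurableSet Ω) (x : EuclideanSpace ℝ (Fin n)) :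
    degreeFn Ω h ε x = ∫ y in Ω, radialKernel h ε x y := by
  simp [degreeFn, smoothingOp_indicator hΩ]

theorem normalizationFn_eq (hΩ : MeasurableSet Ω) (x : EuclideanSpace ℝ (Fin n)) :
    normalizationFn Ω h ε x = ∫ y in Ω, radialKernel h ε x y / degreeFn Ω h ε y := by
  rw [normalizationFn, smoothingOp_indicator hΩ]
  simp [div_eq_mul_inv]

theorem measurable_degreeFn (hΩ : MeasurableSet Ω) (hd : IsRadiallyDecreasing h) :
    Measurable (degreeFn Ω h ε) := by
  have : degreeFn Ω h ε = fun x => ∫ y in Ω, radialKernel h ε x y := by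
    ext x; exact degreeFn_eq hΩ x
  rw [this]
  exact ((measurable_radialKernel hd).stronglyMeasurable.integral_prod_right).measurable

theorem measurable_normalizationFn (hΩ : MeasurableSet Ω) (hd : IsRadiallyDecreasing h) :
    Measurable (normalizationFn Ω h ε) := by
  have : normalizationFn Ω h ε = fun x => ∫ y in Ω, radialKernel h ε x y / degreeFn Ω h ε y := by
    ext x; exact normalizationFn_eq hΩ x
  rw [this]
  have hm : Measurable (Function.uncurry fun x y => radialKernel h ε x y / degreeFn Ω h ε y) :=
    (measurable_radialKernel hd).div ((measurable_degreeFn hΩ hd).comp measurable_snd)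
  exact hm.stronglyMeasurable.integral_prod_right.measurable

theorem degreeFn_le_one (hΩ : MeasurableSet Ω) (hs : IsShapeFunction h) (hε : 0 < ε)
    (x : EuclideanSpace ℝ (Fin n)) : degreeFn Ω h ε x ≤ 1 := by
  rw [degreeFn_eq hΩ, ← integral_radialKernel hs hε x]
  exact setIntegral_le_integral (integrable_radialKernel hs hε x)
    (Eventually.of_forall fun y => radialKernel_nonneg hs hε x y)

/-- On a thick domain the degree function is bounded below, uniformly for small `ε`. -/
theorem exists_le_degreeFn (hΩ : MeasurableSet Ω) (ht : IsThick Ω) (hs : IsShapeFunction h)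
    (hd : IsRadiallyDecreasing h) :
    ∃ α > (0 : ℝ), ∃ ε₀ > (0 : ℝ), ∀ ε ∈ Ioo 0 ε₀, ∀ x ∈ Ω, α ≤ degreeFn Ω h ε x := by
  obtain ⟨-, c, hc, ε₁, hε₁, hthick⟩ := ht
  obtain ⟨r, hr, m, hm, hball⟩ := hs.exists_ball_le hd
  set v : ℝ := volume.real (Metric.ball (0 : EuclideanSpace ℝ (Fin n)) 1) with hv
  have hvpos : 0 < v :=
    ENNReal.toReal_pos (Metric.measure_ball_pos _ _ one_pos).ne' measure_ball_lt_top.ne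
  -- On the ball of radius εr about x the kernel is at least ε⁻ⁿm, and Ω fills more than c(εr)ⁿv of
  -- that ball, so the powers of ε cancel. Thickness applies once εr < ε₁.
  refine ⟨m * (c * (r ^ n * v)), by positivity, ε₁ / r, by positivity, fun ε hε x hx => ?_⟩
  obtain ⟨hε0, hε⟩ := hε
  have hεr : ε * r ∈ Ioo 0 ε₁ := ⟨by positivity, (lt_div_iff₀ hr).1 hε⟩
  have hsub := hthick _ hεr x hx
  set B := Metric.ball x (ε * r) ∩ Ω with hB
  have hBm : MeasurableSet B := Metric.isOpen_ball.measurableSet.inter hΩ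
  have hBfin : volume B ≠ ∞ := ((measure_mono inter_subset_left).trans_lt measure_ball_lt_top).ne
  have hvol : c * ((ε * r) ^ n * v) ≤ volume.real B := by
    have h1 : volume (Metric.ball x (ε * r)) = ENNReal.ofReal ((ε * r) ^ n) *
        volume (Metric.ball (0 : EuclideanSpace ℝ (Fin n)) 1) := by
      rw [Measure.addHaar_ball_of_pos _ _ hεr.1, finrank_euclideanSpace_fin]
    have h2 := ENNReal.toReal_mono hBfin hsub.le
    rw [h1, ENNReal.toReal_mul, ENNReal.toReal_mul, ENNReal.toReal_ofReal hc.le,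
      ENNReal.toReal_ofReal (by have := hεr.1; positivity)] at h2
    exact h2
  have hint := integrable_radialKernel hs hε0 x
  have hnn := radialKernel_nonneg hs hε0 x
  have hpos : 0 < ε ^ n := by positivity
  rw [degreeFn_eq hΩ]
  calc m * (c * (r ^ n * v)) = ((ε ^ n)⁻¹ * m) * (c * ((ε * r) ^ n * v)) := by
        rw [mul_pow]; field_simp
    _ ≤ ((ε ^ n)⁻¹ * m) * volume.real B := by gcongr
    _ = ∫ _ in B, (ε ^ n)⁻¹ * m := by simp [mul_comm]
    _ ≤ ∫ y in B, radialKernel h ε x y := by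
        refine setIntegral_mono_on (integrableOn_const hBfin) hint.integrableOn hBm fun y hy => ?_
        refine mul_le_mul_of_nonneg_left (hball _ ?_) (by positivity)
        have := hy.1
        rw [Metric.mem_ball, dist_eq_norm] at this
        rw [norm_smul, Real.norm_of_nonneg (by positivity), inv_mul_lt_iff₀ hε0]
        exact this
    _ ≤ ∫ y in Ω, radialKernel h ε x y :=
        setIntegral_mono_set hint.integrableOn (Eventually.of_forall hnn)
          (Eventually.of_forall inter_subset_right)

end KernelEstimates

/-! ### Schur's test and integrability against bounded densities. -/

section Schur

variable {X : Type*} [MeasurableSpace X] {μ : Measure X}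

/-- Jensen's inequality for a probability density `k`. -/
theorem lintegral_mul_enorm_rpow_le {k : X → ℝ≥0∞} (hk : Measurable k) (hk1 : ∫⁻ y, k y ∂μ = 1)
    {f : X → ℝ} (hf : AEStronglyMeasurable f μ) {p : ℝ≥0∞} (hp : 1 ≤ p) (hp' : p ≠ ∞) :
    (∫⁻ y, k y * ‖f y‖ₑ ∂μ) ^ p.toReal ≤ ∫⁻ y, k y * ‖f y‖ₑ ^ p.toReal ∂μ := by
  have hp0 : p ≠ 0 := (one_pos.trans_le hp).ne'
  have hpos : 0 < p.toReal := ENNReal.toReal_pos hp0 hp'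
  -- On the probability measure kμ the L¹ norm is at most the L^p norm.
  set ν := μ.withDensity k with hν
  have : IsProbabilityMeasure ν := ⟨by simp [hν, hk1]⟩
  have hac : ν ≪ μ := withDensity_absolutelyContinuous _ _
  have h := eLpNorm_le_eLpNorm_of_exponent_le hp (hf.mono_ac hac)
  rw [eLpNorm_one_eq_lintegral_enorm, eLpNorm_eq_lintegral_rpow_enorm_toReal hp0 hp',
    one_div, ENNReal.le_rpow_inv_iff hpos,
    lintegral_withDensity_eq_lintegral_mul₀ hk.aemeasurable hf.enorm,
    lintegral_withDensity_eq_lintegral_mul₀ hk.aemeasurable (hf.enorm.pow_const _)] at h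
  exact h

/-- Schur's test for a doubly stochastic kernel. -/
theorem eLpNorm_le_of_doublyStochastic [SFinite μ] {K : X → X → ℝ≥0∞}
    (hK : Measurable (Function.uncurry K)) (h₁ : ∀ᵐ x ∂μ, ∫⁻ y, K x y ∂μ = 1)
    (h₂ : ∀ᵐ y ∂μ, ∫⁻ x, K x y ∂μ = 1) {f g : X → ℝ} (hf : AEStronglyMeasurable f μ)
    (hg : ∀ᵐ x ∂μ, ‖g x‖ₑ ≤ ∫⁻ y, K x y * ‖f y‖ₑ ∂μ) {p : ℝ≥0∞} (hp : 1 ≤ p) :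
    eLpNorm g p μ ≤ eLpNorm f p μ := by
  have hKx : ∀ x, Measurable (K x) := fun x => hK.comp measurable_prodMk_left
  have hKy : ∀ y, Measurable fun x => K x y := fun y => hK.comp measurable_prodMk_right
  by_cases hp' : p = ∞
  · subst hp'
    rw [eLpNorm_exponent_top, eLpNorm_exponent_top]
    refine essSup_le_of_ae_le _ ?_
    filter_upwards [h₁, hg] with x hx hgx
    calc ‖g x‖ₑ ≤ ∫⁻ y, K x y * ‖f y‖ₑ ∂μ := hgx
      _ ≤ ∫⁻ y, K x y * eLpNormEssSup f μ ∂μ := by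
          refine lintegral_mono_ae ?_
          filter_upwards [enorm_ae_le_eLpNormEssSup f μ] with y hy
          gcongr
      _ = eLpNormEssSup f μ := by rw [lintegral_mul_const _ (hKx x), hx, one_mul]
  · have hp0 : p ≠ 0 := (one_pos.trans_le hp).ne'
    rw [eLpNorm_eq_lintegral_rpow_enorm_toReal hp0 hp',
      eLpNorm_eq_lintegral_rpow_enorm_toReal hp0 hp']
    refine ENNReal.rpow_le_rpow ?_ (by positivity)
    -- Unit row sums allow Jensen for each x; after Tonelli, unit column sums remove the kernel.
    calc ∫⁻ x, ‖g x‖ₑ ^ p.toReal ∂μ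
        ≤ ∫⁻ x, ∫⁻ y, K x y * ‖f y‖ₑ ^ p.toReal ∂μ ∂μ := by
          refine lintegral_mono_ae ?_
          filter_upwards [h₁, hg] with x hx hgx
          exact (ENNReal.rpow_le_rpow hgx (by positivity)).trans
            (lintegral_mul_enorm_rpow_le (hKx x) hx hf hp hp')
      _ = ∫⁻ y, ∫⁻ x, K x y * ‖f y‖ₑ ^ p.toReal ∂μ ∂μ := by
          refine lintegral_lintegral_swap (hK.aemeasurable.mul ?_)
          exact (hf.enorm.pow_const _).comp_snd
      _ = ∫⁻ y, ‖f y‖ₑ ^ p.toReal ∂μ := by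
          refine lintegral_congr_ae ?_
          filter_upwards [h₂] with y hy
          rw [lintegral_mul_const _ (hKy y), hy, one_mul]

/-- A bounded integrable density multiplies every `L^p` space into `L¹`. -/
theorem integrable_mul_of_le_of_lintegral_lt_top {k f : X → ℝ} (hk : Measurable k)
    (hk0 : 0 ≤ᵐ[μ] k) {C : ℝ} (hkC : ∀ᵐ x ∂μ, k x ≤ C) (hki : ∫⁻ x, ENNReal.ofReal (k x) ∂μ < ∞)
    {p : ℝ≥0∞} (hp : 1 ≤ p) (hf : MemLp f p μ) : Integrable (fun x => k x * f x) μ := by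
  set ν := μ.withDensity fun x => ENNReal.ofReal (k x) with hν
  have : IsFiniteMeasure ν := ⟨by simpa [hν] using hki⟩
  -- The bound on `k` puts `f` in L^p(kμ), and finiteness of kμ then puts it in L¹(kμ).
  have hle : ν ≤ ENNReal.ofReal C • μ := by
    rw [hν, ← withDensity_const]
    exact withDensity_mono (by filter_upwards [hkC] with x hx using ENNReal.ofReal_le_ofReal hx)
  have h1 : Integrable f ν :=
    (hf.of_measure_le_smul ENNReal.ofReal_ne_top hle).integrable hp
  rw [hν, integrable_withDensity_iff_integrable_smul' hk.ennreal_ofReal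
    (Eventually.of_forall fun x => ENNReal.ofReal_lt_top)] at h1
  refine h1.congr ?_
  filter_upwards [hk0] with x hx
  rw [ENNReal.toReal_ofReal hx, smul_eq_mul]

end Schur

/-! ### Positivity, bounds and unit mass of the bistochastic kernel. -/

section BistochasticKernel

variable {n : ℕ} {Ω : Set (EuclideanSpace ℝ (Fin n))} {h : EuclideanSpace ℝ (Fin n) → ℝ}
  {ε α : ℝ}

theorem degreeFn_pos_of_le (hα : 0 < α) (hdeg : ∀ x ∈ Ω, α ≤ degreeFn Ω h ε x)
    {x : EuclideanSpace ℝ (Fin n)} (hx : x ∈ Ω) : 0 < degreeFn Ω h ε x :=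
  hα.trans_le (hdeg x hx)

theorem integrableOn_radialKernel_div_degreeFn (hΩ : MeasurableSet Ω) (hs : IsShapeFunction h)
    (hd : IsRadiallyDecreasing h) (hε : 0 < ε) (hα : 0 < α)
    (hdeg : ∀ x ∈ Ω, α ≤ degreeFn Ω h ε x) (z : EuclideanSpace ℝ (Fin n)) :
    IntegrableOn (fun y => radialKernel h ε z y / degreeFn Ω h ε y) Ω := by
  have hk := integrable_radialKernel hs hε z
  refine (hk.integrableOn.const_mul α⁻¹).mono'
    (((measurable_radialKernel hd).comp measurable_prodMk_left).div
      (measurable_degreeFn hΩ hd)).aestronglyMeasurable ?_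
  filter_upwards [ae_restrict_mem hΩ] with y hy
  have hnn := radialKernel_nonneg hs hε z y
  have hpos := degreeFn_pos_of_le hα hdeg hy
  rw [Real.norm_of_nonneg (by positivity), div_eq_mul_inv, mul_comm]
  have := hdeg y hy
  gcongr

/-- Dividing the integrand of d_ε by d_ε ≤ 1 only increases it, so q_ε ≥ d_ε on Ω. -/
theorem le_normalizationFn (hΩ : MeasurableSet Ω) (hs : IsShapeFunction h)
    (hd : IsRadiallyDecreasing h) (hε : 0 < ε) (hα : 0 < α)
    (hdeg : ∀ x ∈ Ω, α ≤ degreeFn Ω h ε x) {z : EuclideanSpace ℝ (Fin n)} (hz : z ∈ Ω) :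
    α ≤ normalizationFn Ω h ε z := by
  refine (hdeg z hz).trans ?_
  rw [degreeFn_eq hΩ, normalizationFn_eq hΩ]
  refine setIntegral_mono_on (integrable_radialKernel hs hε z).integrableOn
    (integrableOn_radialKernel_div_degreeFn hΩ hs hd hε hα hdeg z) hΩ fun y hy => ?_
  exact (le_div_iff₀ (degreeFn_pos_of_le hα hdeg hy)).2
    (mul_le_of_le_one_right (radialKernel_nonneg hs hε z y) (degreeFn_le_one hΩ hs hε y))

theorem measurable_bistochIntegrand (hΩ : MeasurableSet Ω) (hd : IsRadiallyDecreasing h) :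
    Measurable fun t : (EuclideanSpace ℝ (Fin n) × EuclideanSpace ℝ (Fin n)) ×
      EuclideanSpace ℝ (Fin n) => bistochIntegrand Ω h ε t.1.1 t.1.2 t.2 := by
  have hk := measurable_radialKernel (ε := ε) hd
  have hd' := measurable_degreeFn (ε := ε) hΩ hd
  have hq := measurable_normalizationFn (ε := ε) hΩ hd
  refine Measurable.div (Measurable.mul ?_ ?_) (Measurable.mul (Measurable.mul ?_ ?_) ?_)
  · exact hk.comp (measurable_fst.fst.prodMk measurable_snd)
  · exact hk.comp (measurable_snd.prodMk measurable_fst.snd)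
  · exact hd'.comp measurable_fst.fst
  · exact hq.comp measurable_snd
  · exact hd'.comp measurable_fst.snd

theorem bistochIntegrand_comm (hd : IsRadiallyDecreasing h) (x y z : EuclideanSpace ℝ (Fin n)) :
    bistochIntegrand Ω h ε x y z = bistochIntegrand Ω h ε y x z := by
  unfold bistochIntegrand
  rw [radialKernel_comm hd x z, radialKernel_comm hd z y]
  ring

theorem bistochKernel_comm (hd : IsRadiallyDecreasing h) (x y : EuclideanSpace ℝ (Fin n)) :
    bistochKernel Ω h ε x y = bistochKernel Ω h ε y x := by
  simp only [bistochKernel, bistochIntegrand_comm hd x y]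

/-- Isolates the dependence on y: its integral is q_ε(z), or, against f, the inner integral in
`presmoothed`. -/
theorem bistochIntegrand_eq (x y z : EuclideanSpace ℝ (Fin n)) :
    bistochIntegrand Ω h ε x y z =
      radialKernel h ε x z / (degreeFn Ω h ε x * normalizationFn Ω h ε z) *
        (radialKernel h ε z y / degreeFn Ω h ε y) := by
  rw [bistochIntegrand, div_mul_div_comm]

theorem measurable_bistochKernel (hΩ : MeasurableSet Ω) (hd : IsRadiallyDecreasing h) :
    Measurable (Function.uncurry (bistochKernel Ω h ε)) :=
  (StronglyMeasurable.integral_prod_right (ν := volume.restrict Ω)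
    (f := fun (t : EuclideanSpace ℝ (Fin n) × EuclideanSpace ℝ (Fin n)) z =>
      bistochIntegrand Ω h ε t.1 t.2 z)
    (measurable_bistochIntegrand hΩ hd).stronglyMeasurable).measurable

theorem bistochIntegrand_nonneg (hΩ : MeasurableSet Ω) (hs : IsShapeFunction h)
    (hd : IsRadiallyDecreasing h) (hε : 0 < ε) (hα : 0 < α)
    (hdeg : ∀ x ∈ Ω, α ≤ degreeFn Ω h ε x) {x y z : EuclideanSpace ℝ (Fin n)} (hx : x ∈ Ω)
    (hy : y ∈ Ω) (hz : z ∈ Ω) : 0 ≤ bistochIntegrand Ω h ε x y z := by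
  have h1 := radialKernel_nonneg hs hε x z
  have h2 := radialKernel_nonneg hs hε z y
  have h3 := degreeFn_pos_of_le hα hdeg hx
  have h4 := degreeFn_pos_of_le hα hdeg hy
  have h5 := hα.trans_le (le_normalizationFn hΩ hs hd hε hα hdeg hz)
  unfold bistochIntegrand
  positivity

theorem bistochIntegrand_le (hΩ : MeasurableSet Ω) (hs : IsShapeFunction h)
    (hd : IsRadiallyDecreasing h) (hε : 0 < ε) (hα : 0 < α)
    (hdeg : ∀ x ∈ Ω, α ≤ degreeFn Ω h ε x) {x y z : EuclideanSpace ℝ (Fin n)} (hx : x ∈ Ω)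
    (hy : y ∈ Ω) (hz : z ∈ Ω) :
    bistochIntegrand Ω h ε x y z ≤
      (α * α * α)⁻¹ * (radialKernel h ε x z * radialKernel h ε z y) := by
  have h1 := radialKernel_nonneg hs hε x z
  have h2 := radialKernel_nonneg hs hε z y
  have h3 := hdeg x hx
  have h4 := hdeg y hy
  have h5 := le_normalizationFn hΩ hs hd hε hα hdeg hz
  have h6 := hα.le.trans h3
  have h7 := hα.le.trans h5
  rw [bistochIntegrand, div_eq_inv_mul]
  gcongr

/-- Only one kernel factor is replaced by its supremum; the other keeps the bound integrable in z
even if Ω has infinite measure. -/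
theorem bistochIntegrand_le_const (hΩ : MeasurableSet Ω) (hs : IsShapeFunction h)
    (hd : IsRadiallyDecreasing h) (hε : 0 < ε) (hα : 0 < α)
    (hdeg : ∀ x ∈ Ω, α ≤ degreeFn Ω h ε x) {x y z : EuclideanSpace ℝ (Fin n)} (hx : x ∈ Ω)
    (hy : y ∈ Ω) (hz : z ∈ Ω) :
    bistochIntegrand Ω h ε x y z ≤
      (α * α * α)⁻¹ * (((ε ^ n)⁻¹ * h 0) * radialKernel h ε x z) := by
  refine (bistochIntegrand_le hΩ hs hd hε hα hdeg hx hy hz).trans ?_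
  rw [mul_comm (radialKernel h ε x z)]
  have h1 := radialKernel_nonneg hs hε x z
  have h2 := radialKernel_le hd hε z y
  gcongr

theorem integrableOn_bistochIntegrand (hΩ : MeasurableSet Ω) (hs : IsShapeFunction h)
    (hd : IsRadiallyDecreasing h) (hε : 0 < ε) (hα : 0 < α)
    (hdeg : ∀ x ∈ Ω, α ≤ degreeFn Ω h ε x) {x y : EuclideanSpace ℝ (Fin n)} (hx : x ∈ Ω)
    (hy : y ∈ Ω) : IntegrableOn (bistochIntegrand Ω h ε x y) Ω := by
  refine ((((integrable_radialKernel hs hε x).integrableOn.const_mul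
    ((ε ^ n)⁻¹ * h 0)).const_mul (α * α * α)⁻¹)).mono'
    (((measurable_bistochIntegrand hΩ hd).comp
      (measurable_prodMk_left (x := (x, y)))).aestronglyMeasurable) ?_
  filter_upwards [ae_restrict_mem hΩ] with z hz
  rw [Real.norm_of_nonneg (bistochIntegrand_nonneg hΩ hs hd hε hα hdeg hx hy hz)]
  exact bistochIntegrand_le_const hΩ hs hd hε hα hdeg hx hy hz

theorem bistochKernel_nonneg (hΩ : MeasurableSet Ω) (hs : IsShapeFunction h)
    (hd : IsRadiallyDecreasing h) (hε : 0 < ε) (hα : 0 < α)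
    (hdeg : ∀ x ∈ Ω, α ≤ degreeFn Ω h ε x) {x y : EuclideanSpace ℝ (Fin n)} (hx : x ∈ Ω)
    (hy : y ∈ Ω) : 0 ≤ bistochKernel Ω h ε x y :=
  setIntegral_nonneg hΩ fun _ hz => bistochIntegrand_nonneg hΩ hs hd hε hα hdeg hx hy hz

theorem bistochKernel_le (hΩ : MeasurableSet Ω) (hs : IsShapeFunction h)
    (hd : IsRadiallyDecreasing h) (hε : 0 < ε) (hα : 0 < α)
    (hdeg : ∀ x ∈ Ω, α ≤ degreeFn Ω h ε x) {x y : EuclideanSpace ℝ (Fin n)} (hx : x ∈ Ω)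
    (hy : y ∈ Ω) : bistochKernel Ω h ε x y ≤ (α * α * α)⁻¹ * ((ε ^ n)⁻¹ * h 0) := by
  have hk := integrable_radialKernel hs hε x
  have h0 := hs.nonneg 0
  calc bistochKernel Ω h ε x y
      ≤ ∫ z in Ω, (α * α * α)⁻¹ * (((ε ^ n)⁻¹ * h 0) * radialKernel h ε x z) :=
        setIntegral_mono_on (integrableOn_bistochIntegrand hΩ hs hd hε hα hdeg hx hy)
          ((hk.integrableOn.const_mul _).const_mul _) hΩ
          fun z hz => bistochIntegrand_le_const hΩ hs hd hε hα hdeg hx hy hz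
    _ = (α * α * α)⁻¹ * ((ε ^ n)⁻¹ * h 0) * degreeFn Ω h ε x := by
        rw [integral_const_mul, integral_const_mul, degreeFn_eq hΩ, ← mul_assoc]
    _ ≤ (α * α * α)⁻¹ * ((ε ^ n)⁻¹ * h 0) :=
        mul_le_of_le_one_right (by positivity) (degreeFn_le_one hΩ hs hε x)

/-- The bistochastic kernel is a Markov kernel. -/
theorem lintegral_bistochKernel (hΩ : MeasurableSet Ω) (hs : IsShapeFunction h)
    (hd : IsRadiallyDecreasing h) (hε : 0 < ε) (hα : 0 < α)
    (hdeg : ∀ x ∈ Ω, α ≤ degreeFn Ω h ε x) {x : EuclideanSpace ℝ (Fin n)} (hx : x ∈ Ω) :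
    ∫⁻ y in Ω, ENNReal.ofReal (bistochKernel Ω h ε x y) = 1 := by
  have hdx := degreeFn_pos_of_le hα hdeg hx
  have hI := measurable_bistochIntegrand (ε := ε) hΩ hd
  calc ∫⁻ y in Ω, ENNReal.ofReal (bistochKernel Ω h ε x y)
      = ∫⁻ y in Ω, ∫⁻ z in Ω, ENNReal.ofReal (bistochIntegrand Ω h ε x y z) := by
        refine setLIntegral_congr_fun hΩ fun y hy => ?_
        refine ofReal_integral_eq_lintegral_ofReal
          (integrableOn_bistochIntegrand hΩ hs hd hε hα hdeg hx hy) ?_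
        filter_upwards [ae_restrict_mem hΩ] with z hz
        exact bistochIntegrand_nonneg hΩ hs hd hε hα hdeg hx hy hz
    -- Tonelli, so that the inner integral in y becomes q_ε(z) and cancels the denominator.
    _ = ∫⁻ z in Ω, ∫⁻ y in Ω, ENNReal.ofReal (bistochIntegrand Ω h ε x y z) := by
        refine lintegral_lintegral_swap (Measurable.aemeasurable ?_)
        exact (hI.comp ((measurable_const.prodMk measurable_fst).prodMk
          measurable_snd)).ennreal_ofReal
    _ = ∫⁻ z in Ω, ENNReal.ofReal (radialKernel h ε x z / degreeFn Ω h ε x) := by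
        refine setLIntegral_congr_fun hΩ fun z hz => ?_
        have hq := hα.trans_le (le_normalizationFn hΩ hs hd hε hα hdeg hz)
        have hint := (integrableOn_radialKernel_div_degreeFn hΩ hs hd hε hα hdeg z).const_mul
          (radialKernel h ε x z / (degreeFn Ω h ε x * normalizationFn Ω h ε z))
        have hnn : 0 ≤ᵐ[volume.restrict Ω] fun y => bistochIntegrand Ω h ε x y z := by
          filter_upwards [ae_restrict_mem hΩ] with y hy
          exact bistochIntegrand_nonneg hΩ hs hd hε hα hdeg hx hy hz
        simp only [bistochIntegrand_eq] at hnn ⊢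
        rw [← ofReal_integral_eq_lintegral_ofReal hint hnn, integral_const_mul,
          ← normalizationFn_eq hΩ]
        congr 1
        field_simp
    _ = 1 := by
        rw [← ofReal_integral_eq_lintegral_ofReal
          ((integrable_radialKernel hs hε x).integrableOn.div_const _)
          (Eventually.of_forall fun z => div_nonneg (radialKernel_nonneg hs hε x z) hdx.le),
          integral_div, ← degreeFn_eq hΩ, div_self hdx.ne', ENNReal.ofReal_one]

end BistochasticKernel

/-! ### Contraction on L^p, the factorization of the operator, and regularity. -/

section BistochasticOperator

variable {n : ℕ} {Ω : Set (EuclideanSpace ℝ (Fin n))} {h : EuclideanSpace ℝ (Fin n) → ℝ}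
  {ε α : ℝ}

theorem measurable_bistochKernel_right (hΩ : MeasurableSet Ω) (hd : IsRadiallyDecreasing h)
    (x : EuclideanSpace ℝ (Fin n)) : Measurable (bistochKernel Ω h ε x) := by
  have h1 := (measurable_bistochKernel (ε := ε) hΩ hd).comp (measurable_prodMk_left (x := x))
  exact h1

theorem integral_bistochKernel (hΩ : MeasurableSet Ω) (hs : IsShapeFunction h)
    (hd : IsRadiallyDecreasing h) (hε : 0 < ε) (hα : 0 < α)
    (hdeg : ∀ x ∈ Ω, α ≤ degreeFn Ω h ε x) {x : EuclideanSpace ℝ (Fin n)} (hx : x ∈ Ω) :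
    ∫ y in Ω, bistochKernel Ω h ε x y = 1 := by
  rw [integral_eq_lintegral_of_nonneg_ae, lintegral_bistochKernel hΩ hs hd hε hα hdeg hx,
    ENNReal.toReal_one]
  · filter_upwards [ae_restrict_mem hΩ] with y hy
    exact bistochKernel_nonneg hΩ hs hd hε hα hdeg hx hy
  · exact (measurable_bistochKernel_right hΩ hd x).aestronglyMeasurable

theorem integrableOn_bistochKernel_mul (hΩ : MeasurableSet Ω) (hs : IsShapeFunction h)
    (hd : IsRadiallyDecreasing h) (hε : 0 < ε) (hα : 0 < α)
    (hdeg : ∀ x ∈ Ω, α ≤ degreeFn Ω h ε x) {p : ℝ≥0∞} (hp : 1 ≤ p)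
    {f : EuclideanSpace ℝ (Fin n) → ℝ} (hf : MemLp f p (volume.restrict Ω))
    {x : EuclideanSpace ℝ (Fin n)} (hx : x ∈ Ω) :
    IntegrableOn (fun y => bistochKernel Ω h ε x y * f y) Ω := by
  refine integrable_mul_of_le_of_lintegral_lt_top
    (measurable_bistochKernel_right hΩ hd x)
    (C := (α * α * α)⁻¹ * ((ε ^ n)⁻¹ * h 0)) ?_ ?_ ?_ hp hf
  · filter_upwards [ae_restrict_mem hΩ] with y hy
    exact bistochKernel_nonneg hΩ hs hd hε hα hdeg hx hy
  · filter_upwards [ae_restrict_mem hΩ] with y hy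
    exact bistochKernel_le hΩ hs hd hε hα hdeg hx hy
  · rw [lintegral_bistochKernel hΩ hs hd hε hα hdeg hx]
    exact ENNReal.one_lt_top

theorem aestronglyMeasurable_bistochOp (hΩ : MeasurableSet Ω) (hd : IsRadiallyDecreasing h)
    {f : EuclideanSpace ℝ (Fin n) → ℝ} (hf : AEStronglyMeasurable f (volume.restrict Ω)) :
    AEStronglyMeasurable (bistochOp Ω h ε f) (volume.restrict Ω) := by
  have h1 : AEStronglyMeasurable
      (fun t : EuclideanSpace ℝ (Fin n) × EuclideanSpace ℝ (Fin n) =>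
        bistochKernel Ω h ε t.1 t.2 * f t.2)
      ((volume.restrict Ω).prod (volume.restrict Ω)) :=
    (measurable_bistochKernel hΩ hd).aestronglyMeasurable.mul hf.comp_snd
  exact h1.integral_prod_right'

/-- Symmetry of the kernel turns unit row sums into unit column sums, so Schur's test applies with
constant one. -/
theorem eLpNorm_bistochOp_le (hΩ : MeasurableSet Ω) (hs : IsShapeFunction h)
    (hd : IsRadiallyDecreasing h) (hε : 0 < ε) (hα : 0 < α)
    (hdeg : ∀ x ∈ Ω, α ≤ degreeFn Ω h ε x) {p : ℝ≥0∞} (hp : 1 ≤ p)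
    {f : EuclideanSpace ℝ (Fin n) → ℝ} (hf : AEStronglyMeasurable f (volume.restrict Ω)) :
    eLpNorm (bistochOp Ω h ε f) p (volume.restrict Ω) ≤ eLpNorm f p (volume.restrict Ω) := by
  have hone : ∀ᵐ x ∂(volume.restrict Ω),
      ∫⁻ y in Ω, ENNReal.ofReal (bistochKernel Ω h ε x y) = 1 := by
    filter_upwards [ae_restrict_mem hΩ] with x hx
    exact lintegral_bistochKernel hΩ hs hd hε hα hdeg hx
  refine eLpNorm_le_of_doublyStochastic (K := fun x y => ENNReal.ofReal (bistochKernel Ω h ε x y))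
    (measurable_bistochKernel hΩ hd).ennreal_ofReal hone ?_ hf ?_ hp
  · filter_upwards [hone] with y hy
    simpa only [bistochKernel_comm hd _ y] using hy
  · filter_upwards [ae_restrict_mem hΩ] with x hx
    refine (enorm_integral_le_lintegral_enorm _).trans (le_of_eq ?_)
    refine setLIntegral_congr_fun hΩ fun y hy => ?_
    simp only [enorm_mul]
    rw [Real.enorm_of_nonneg (bistochKernel_nonneg hΩ hs hd hε hα hdeg hx hy)]

theorem memLp_bistochOp (hΩ : MeasurableSet Ω) (hs : IsShapeFunction h)
    (hd : IsRadiallyDecreasing h) (hε : 0 < ε) (hα : 0 < α)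
    (hdeg : ∀ x ∈ Ω, α ≤ degreeFn Ω h ε x) {p : ℝ≥0∞} (hp : 1 ≤ p)
    {f : EuclideanSpace ℝ (Fin n) → ℝ} (hf : MemLp f p (volume.restrict Ω)) :
    MemLp (bistochOp Ω h ε f) p (volume.restrict Ω) :=
  ⟨aestronglyMeasurable_bistochOp hΩ hd hf.1,
    (eLpNorm_bistochOp_le hΩ hs hd hε hα hdeg hp hf.1).trans_lt hf.2⟩

/-- The function whose convolution with the rescaled shape, divided by the degree function, is
`bistochOp Ω h ε f`. -/
noncomputable def presmoothed (Ω : Set (EuclideanSpace ℝ (Fin n)))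
    (h : EuclideanSpace ℝ (Fin n) → ℝ) (ε : ℝ) (f : EuclideanSpace ℝ (Fin n) → ℝ) :
    EuclideanSpace ℝ (Fin n) → ℝ :=
  Ω.indicator fun z => (normalizationFn Ω h ε z)⁻¹ *
    ∫ y in Ω, radialKernel h ε z y / degreeFn Ω h ε y * f y

/-- Fubini, justified by a bounded integrand, f ∈ L¹(Ω) and finite measure. All dependence on x is
now in d_ε and in a correlation with `h`. -/
theorem bistochOp_eq (hΩ : MeasurableSet Ω) (hs : IsShapeFunction h)
    (hd : IsRadiallyDecreasing h) (hε : 0 < ε) (hα : 0 < α)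
    (hdeg : ∀ x ∈ Ω, α ≤ degreeFn Ω h ε x) (hfin : volume Ω ≠ ∞)
    {f : EuclideanSpace ℝ (Fin n) → ℝ} (hf : IntegrableOn f Ω)
    {x : EuclideanSpace ℝ (Fin n)} (hx : x ∈ Ω) :
    bistochOp Ω h ε f x =
      (degreeFn Ω h ε x)⁻¹ * ∫ z, radialKernel h ε x z * presmoothed Ω h ε f z := by
  have : IsFiniteMeasure (volume.restrict Ω) := ⟨by simpa using hfin.lt_top⟩
  have hI : Measurable fun t : EuclideanSpace ℝ (Fin n) × EuclideanSpace ℝ (Fin n) =>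
      bistochIntegrand Ω h ε x t.1 t.2 := by
    have hm : Measurable fun t : EuclideanSpace ℝ (Fin n) × EuclideanSpace ℝ (Fin n) =>
        ((x, t.1), t.2) := (measurable_const.prodMk measurable_fst).prodMk measurable_snd
    have h1 := (measurable_bistochIntegrand (ε := ε) hΩ hd).comp hm
    exact h1
  have h0 := hs.nonneg 0
  have hint : Integrable (fun t : EuclideanSpace ℝ (Fin n) × EuclideanSpace ℝ (Fin n) =>
      bistochIntegrand Ω h ε x t.1 t.2 * f t.1)
      ((volume.restrict Ω).prod (volume.restrict Ω)) := by
    refine Integrable.bdd_mul (c := (α * α * α)⁻¹ * (((ε ^ n)⁻¹ * h 0) * ((ε ^ n)⁻¹ * h 0)))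
      (Integrable.comp_fst hf _) hI.aestronglyMeasurable ?_
    rw [Measure.prod_restrict]
    filter_upwards [ae_restrict_mem (hΩ.prod hΩ)] with t ht
    rw [Real.norm_of_nonneg (bistochIntegrand_nonneg hΩ hs hd hε hα hdeg hx ht.1 ht.2)]
    refine (bistochIntegrand_le_const hΩ hs hd hε hα hdeg hx ht.1 ht.2).trans ?_
    have := radialKernel_le hd hε x t.2
    gcongr
  calc bistochOp Ω h ε f x
      = ∫ y in Ω, ∫ z in Ω, bistochIntegrand Ω h ε x y z * f y := by
        simp only [bistochOp, bistochKernel, integral_mul_const]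
    _ = ∫ z in Ω, ∫ y in Ω, bistochIntegrand Ω h ε x y z * f y := integral_integral_swap hint
    _ = ∫ z in Ω, (degreeFn Ω h ε x)⁻¹ * (radialKernel h ε x z *
          ((normalizationFn Ω h ε z)⁻¹ *
            ∫ y in Ω, radialKernel h ε z y / degreeFn Ω h ε y * f y)) := by
        refine integral_congr_ae (Eventually.of_forall fun z => ?_)
        simp only [bistochIntegrand_eq, mul_assoc, integral_const_mul]
        ring
    _ = (degreeFn Ω h ε x)⁻¹ * ∫ z, radialKernel h ε x z * presmoothed Ω h ε f z := by
        rw [integral_const_mul, ← smoothingOp_indicator hΩ]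
        rfl

theorem abs_integral_radialKernel_div_mul_le (hΩ : MeasurableSet Ω) (hs : IsShapeFunction h)
    (hε : 0 < ε) (hα : 0 < α) (hdeg : ∀ x ∈ Ω, α ≤ degreeFn Ω h ε x)
    {f : EuclideanSpace ℝ (Fin n) → ℝ} {z : EuclideanSpace ℝ (Fin n)}
    (hf : IntegrableOn (fun y => radialKernel h ε z y * |f y|) Ω) :
    |∫ y in Ω, radialKernel h ε z y / degreeFn Ω h ε y * f y| ≤
      α⁻¹ * ∫ y in Ω, radialKernel h ε z y * |f y| := by
  rw [← Real.norm_eq_abs, ← integral_const_mul]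
  refine norm_integral_le_of_norm_le (hf.const_mul _) ?_
  filter_upwards [ae_restrict_mem hΩ] with y hy
  have hnn := radialKernel_nonneg hs hε z y
  have hpos := degreeFn_pos_of_le hα hdeg hy
  have := hdeg y hy
  rw [norm_mul, Real.norm_of_nonneg (by positivity), Real.norm_eq_abs, div_eq_inv_mul, mul_assoc]
  gcongr

/-- One `α⁻¹` pays for 1/q_ε, the other for 1/d_ε. -/
theorem abs_presmoothed_le (hΩ : MeasurableSet Ω) (hs : IsShapeFunction h)
    (hd : IsRadiallyDecreasing h) (hε : 0 < ε) (hα : 0 < α)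
    (hdeg : ∀ x ∈ Ω, α ≤ degreeFn Ω h ε x) {f : EuclideanSpace ℝ (Fin n) → ℝ}
    {z : EuclideanSpace ℝ (Fin n)}
    (hf : IntegrableOn (fun y => radialKernel h ε z y * |f y|) Ω) :
    |presmoothed Ω h ε f z| ≤ α⁻¹ * (α⁻¹ * ∫ y in Ω, radialKernel h ε z y * |f y|) := by
  have hnn : 0 ≤ ∫ y in Ω, radialKernel h ε z y * |f y| :=
    integral_nonneg fun y => mul_nonneg (radialKernel_nonneg hs hε z y) (abs_nonneg _)
  by_cases hz : z ∈ Ω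
  · have hq := le_normalizationFn hΩ hs hd hε hα hdeg hz
    rw [presmoothed, indicator_of_mem hz, abs_mul, abs_of_pos (inv_pos.2 (hα.trans_le hq))]
    have := abs_integral_radialKernel_div_mul_le hΩ hs hε hα hdeg hf
    gcongr
  · rw [presmoothed, indicator_of_notMem hz, abs_zero]
    positivity

theorem integrableOn_radialKernel_mul_abs (hs : IsShapeFunction h)
    (hd : IsRadiallyDecreasing h) (hε : 0 < ε) {f : EuclideanSpace ℝ (Fin n) → ℝ}
    (hf : IntegrableOn f Ω) (z : EuclideanSpace ℝ (Fin n)) :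
    IntegrableOn (fun y => radialKernel h ε z y * |f y|) Ω := by
  refine Integrable.bdd_mul (c := (ε ^ n)⁻¹ * h 0) hf.abs
    (integrable_radialKernel hs hε z).aestronglyMeasurable.restrict
    (Eventually.of_forall fun y => ?_)
  rw [Real.norm_of_nonneg (radialKernel_nonneg hs hε z y)]
  exact radialKernel_le hd hε z y

/-- Boundedness of k_ε takes L¹ data to bounded functions, as the correlation lemmas require. -/
theorem exists_abs_presmoothed_le (hΩ : MeasurableSet Ω) (hs : IsShapeFunction h)
    (hd : IsRadiallyDecreasing h) (hε : 0 < ε) (hα : 0 < α)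
    (hdeg : ∀ x ∈ Ω, α ≤ degreeFn Ω h ε x) {f : EuclideanSpace ℝ (Fin n) → ℝ}
    (hf : IntegrableOn f Ω) : ∃ M, ∀ z, |presmoothed Ω h ε f z| ≤ M := by
  refine ⟨α⁻¹ * (α⁻¹ * ∫ y in Ω, ((ε ^ n)⁻¹ * h 0) * |f y|), fun z => ?_⟩
  have hint := integrableOn_radialKernel_mul_abs hs hd hε hf z
  refine (abs_presmoothed_le hΩ hs hd hε hα hdeg hint).trans ?_
  have : ∫ y in Ω, radialKernel h ε z y * |f y| ≤ ∫ y in Ω, ((ε ^ n)⁻¹ * h 0) * |f y| :=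
    integral_mono hint (hf.abs.const_mul _) fun y =>
      mul_le_mul_of_nonneg_right (radialKernel_le hd hε z y) (abs_nonneg _)
  gcongr

theorem aestronglyMeasurable_presmoothed (hΩ : MeasurableSet Ω) (hd : IsRadiallyDecreasing h)
    {f : EuclideanSpace ℝ (Fin n) → ℝ} (hf : AEStronglyMeasurable f (volume.restrict Ω)) :
    AEStronglyMeasurable (presmoothed Ω h ε f) := by
  rw [presmoothed, aestronglyMeasurable_indicator_iff hΩ]
  refine (measurable_normalizationFn hΩ hd).inv.aestronglyMeasurable.mul ?_
  have h1 : AEStronglyMeasurable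
      (fun t : EuclideanSpace ℝ (Fin n) × EuclideanSpace ℝ (Fin n) =>
        radialKernel h ε t.1 t.2 / degreeFn Ω h ε t.2 * f t.2)
      ((volume.restrict Ω).prod (volume.restrict Ω)) :=
    ((measurable_radialKernel hd).div
      ((measurable_degreeFn hΩ hd).comp measurable_snd)).aestronglyMeasurable.mul hf.comp_snd
  exact h1.integral_prod_right'

theorem integrable_presmoothed (hΩ : MeasurableSet Ω) (hs : IsShapeFunction h)
    (hd : IsRadiallyDecreasing h) (hε : 0 < ε) (hα : 0 < α)
    (hdeg : ∀ x ∈ Ω, α ≤ degreeFn Ω h ε x) (hfin : volume Ω ≠ ∞)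
    {f : EuclideanSpace ℝ (Fin n) → ℝ} (hf : IntegrableOn f Ω) :
    Integrable (presmoothed Ω h ε f) := by
  obtain ⟨M, hM⟩ := exists_abs_presmoothed_le hΩ hs hd hε hα hdeg hf
  have h1 : IntegrableOn (presmoothed Ω h ε f) Ω :=
    Measure.integrableOn_of_bounded hfin (aestronglyMeasurable_presmoothed hΩ hd hf.1)
      (Eventually.of_forall hM)
  rw [← integrable_indicator_iff hΩ] at h1
  simpa only [presmoothed, indicator_indicator, inter_self] using h1

theorem continuous_integral_radialKernel_mul (hs : IsShapeFunction h) (hε : 0 < ε)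
    {w : EuclideanSpace ℝ (Fin n) → ℝ} (hw : AEStronglyMeasurable w) {M : ℝ}
    (hM : ∀ y, |w y| ≤ M) : Continuous fun x => ∫ z, radialKernel h ε x z * w z :=
  continuous_integral_sub_mul (integrable_scaledShape hs hε) hw hM

/-- The substitution moves the scaling from `h` to `w`: the integral is the correlation of `h` with
w(ε·), evaluated at x/ε. The Sobolev hypothesis on `h` itself then suffices. -/
theorem contDiff_integral_radialKernel_mul (hs : IsShapeFunction h)
    (hd : IsRadiallyDecreasing h) (hε : 0 < ε) {r : ℕ} (hr : MemSobolevH r h)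
    {w : EuclideanSpace ℝ (Fin n) → ℝ} (hw : Integrable w) {M : ℝ}
    (hM : ∀ y, |w y| ≤ M) : ContDiff ℝ r fun x => ∫ z, radialKernel h ε x z * w z := by
  obtain ⟨hh, hhr⟩ := hr
  have hwε : Integrable fun u => w (ε • u) := hw.comp_smul hε.ne'
  have hwε2 : MemLp (fun u => w (ε • u)) 2 := by
    rw [memLp_two_iff_integrable_sq hwε.aestronglyMeasurable]
    simp only [sq]
    exact hwε.mul_bdd (c := M) hwε.aestronglyMeasurable (Eventually.of_forall fun u => hM _)
  have key := contDiff_integral_sub_mul hs.integrable hd.neg hh hwε (fun y => hM (ε • y))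
    hwε2.ofReal r hhr
  have heq : (fun x => ∫ z, radialKernel h ε x z * w z) =
      (fun x => ∫ u, h (u - x) * w (ε • u)) ∘ fun x => ε⁻¹ • x := by
    ext x
    rw [integral_radialKernel_mul hε, Function.comp_apply,
      ← integral_sub_right_eq_self _ (ε⁻¹ • x)]
    simp [smul_sub, smul_smul, hε.ne']
  rw [heq]
  exact key.comp (contDiff_const_smul _)

theorem abs_indicator_one_le (z : EuclideanSpace ℝ (Fin n)) :
    |Ω.indicator (fun _ => (1 : ℝ)) z| ≤ 1 := by
  by_cases hz : z ∈ Ω <;> simp [hz]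

/-- Numerator and d_ε are both correlations of the scaled `h` with bounded functions, and d_ε does
not vanish on Ω. -/
theorem continuousOn_bistochOp (hΩ : MeasurableSet Ω) (hs : IsShapeFunction h)
    (hd : IsRadiallyDecreasing h) (hε : 0 < ε) (hα : 0 < α)
    (hdeg : ∀ x ∈ Ω, α ≤ degreeFn Ω h ε x) (hfin : volume Ω ≠ ∞)
    {f : EuclideanSpace ℝ (Fin n) → ℝ} (hf : IntegrableOn f Ω) :
    ContinuousOn (bistochOp Ω h ε f) Ω := by
  obtain ⟨M, hM⟩ := exists_abs_presmoothed_le hΩ hs hd hε hα hdeg hf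
  have hcd : Continuous (degreeFn Ω h ε) :=
    continuous_integral_radialKernel_mul hs hε
      (measurable_const.indicator hΩ).aestronglyMeasurable abs_indicator_one_le
  have hcH := continuous_integral_radialKernel_mul hs hε
    (aestronglyMeasurable_presmoothed hΩ hd hf.1) hM
  exact ((hcd.continuousOn.inv₀ fun x hx => (degreeFn_pos_of_le hα hdeg hx).ne').mul
    hcH.continuousOn).congr fun x hx => bistochOp_eq hΩ hs hd hε hα hdeg hfin hf hx

theorem abs_bistochOp_le (hΩ : MeasurableSet Ω) (hs : IsShapeFunction h)
    (hd : IsRadiallyDecreasing h) (hε : 0 < ε) (hα : 0 < α)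
    (hdeg : ∀ x ∈ Ω, α ≤ degreeFn Ω h ε x)
    {f : EuclideanSpace ℝ (Fin n) → ℝ} (hf : IntegrableOn f Ω)
    {x : EuclideanSpace ℝ (Fin n)} (hx : x ∈ Ω) :
    |bistochOp Ω h ε f x| ≤ (α * α * α)⁻¹ * ((ε ^ n)⁻¹ * h 0) * ∫ y in Ω, |f y| := by
  rw [← Real.norm_eq_abs, ← integral_const_mul]
  refine norm_integral_le_of_norm_le (hf.abs.const_mul _) ?_
  filter_upwards [ae_restrict_mem hΩ] with y hy
  rw [norm_mul, Real.norm_of_nonneg (bistochKernel_nonneg hΩ hs hd hε hα hdeg hx hy),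
    Real.norm_eq_abs]
  exact mul_le_mul_of_nonneg_right (bistochKernel_le hΩ hs hd hε hα hdeg hx hy) (abs_nonneg _)

/-- The same quotient; finite measure makes 1_Ω integrable, so the Fourier argument also covers d_ε.
-/
theorem contDiffOn_bistochOp (hΩ : MeasurableSet Ω) (hs : IsShapeFunction h)
    (hd : IsRadiallyDecreasing h) (hε : 0 < ε) (hα : 0 < α)
    (hdeg : ∀ x ∈ Ω, α ≤ degreeFn Ω h ε x) (hfin : volume Ω ≠ ∞) {r : ℕ} (hr : MemSobolevH r h)
    {f : EuclideanSpace ℝ (Fin n) → ℝ} (hf : IntegrableOn f Ω) :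
    ContDiffOn ℝ r (bistochOp Ω h ε f) Ω := by
  obtain ⟨M, hM⟩ := exists_abs_presmoothed_le hΩ hs hd hε hα hdeg hf
  have hcd : ContDiff ℝ r (degreeFn Ω h ε) :=
    contDiff_integral_radialKernel_mul hs hd hε hr
      ((integrable_indicator_iff hΩ).2 (integrableOn_const hfin)) abs_indicator_one_le
  have hcH := contDiff_integral_radialKernel_mul hs hd hε hr
    (integrable_presmoothed hΩ hs hd hε hα hdeg hfin hf) hM
  exact ((hcd.contDiffOn.inv fun x hx => (degreeFn_pos_of_le hα hdeg hx).ne').mul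
    hcH.contDiffOn).congr fun x hx => bistochOp_eq hΩ hs hd hε hα hdeg hfin hf hx

end BistochasticOperator

/-! ### Strong convergence to the identity as ε → 0. -/

section Convergence

variable {n : ℕ} {Ω : Set (EuclideanSpace ℝ (Fin n))} {h : EuclideanSpace ℝ (Fin n) → ℝ}

/-- Iterated smoothing of a bounded continuous function converges pointwise as `ε → 0`. -/
theorem tendsto_integral_radialKernel_radialKernel (hs : IsShapeFunction h)
    {ψ : EuclideanSpace ℝ (Fin n) → ℝ} (hψ : Continuous ψ) {M : ℝ} (hM : ∀ y, |ψ y| ≤ M)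
    (x : EuclideanSpace ℝ (Fin n)) :
    Tendsto (fun ε => ∫ z, radialKernel h ε x z * ∫ y, radialKernel h ε z y * ψ y)
      (𝓝[>] 0) (𝓝 (ψ x)) := by
  have hh := hs.integrable
  have hbound : ∀ φ : EuclideanSpace ℝ (Fin n) → ℝ, (∀ y, |φ y| ≤ M) → ∀ u,
      ‖h u * φ u‖ ≤ h u * M := fun φ hφ u => by
    rw [norm_mul, Real.norm_of_nonneg (hs.nonneg u)]
    exact mul_le_mul_of_nonneg_left (hφ u) (hs.nonneg u)
  -- After rescaling both displacements, ε appears only inside `ψ`. The expression makes sense and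
  -- is continuous at ε = 0, where it equals ψ(x).
  set I : ℝ → EuclideanSpace ℝ (Fin n) → ℝ :=
    fun ε u => ∫ v, h v * ψ (x + ε • u + ε • v) with hI
  have hIcont : Continuous fun t : ℝ × EuclideanSpace ℝ (Fin n) => I t.1 t.2 := by
    refine continuous_of_dominated (bound := fun v => h v * M) (fun t => ?_)
      (fun t => Eventually.of_forall (hbound _ fun v => hM _)) (hh.mul_const M)
      (Eventually.of_forall fun v => by fun_prop)
    exact hh.aestronglyMeasurable.mul (by fun_prop : Continuous _).aestronglyMeasurable
  have hIM : ∀ ε u, |I ε u| ≤ M := fun ε u => by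
    have h1 := norm_integral_le_of_norm_le (hh.mul_const M)
      (Eventually.of_forall (hbound (fun v => ψ (x + ε • u + ε • v)) fun v => hM _))
    rwa [integral_mul_const, hs.integral_eq_one, one_mul] at h1
  have hS : Continuous fun ε : ℝ => ∫ u, h u * I ε u := by
    refine continuous_of_dominated (bound := fun v => h v * M) (fun ε => ?_)
      (fun ε => Eventually.of_forall (hbound _ fun v => hIM _ _)) (hh.mul_const M)
      (Eventually.of_forall fun v => ?_)
    · exact hh.aestronglyMeasurable.mul
        (hIcont.comp (continuous_const.prodMk continuous_id)).aestronglyMeasurable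
    · exact continuous_const.mul (hIcont.comp (continuous_id.prodMk continuous_const))
  have h0 : ∫ u, h u * I 0 u = ψ x := by
    simp [hI, integral_mul_const, hs.integral_eq_one]
  have hlim := (hS.tendsto 0).mono_left (nhdsWithin_le_nhds (s := Ioi 0))
  rw [h0] at hlim
  refine hlim.congr' ?_
  filter_upwards [self_mem_nhdsWithin] with ε hε
  rw [integral_radialKernel_mul hε]
  refine integral_congr_ae (Eventually.of_forall fun u => ?_)
  simp only [hI, integral_radialKernel_mul hε]

/-- Unit mass lets g(x) enter the integral. Since |g − g(x)| ≥ 0, the weights 1/d_ε(x), 1/q_ε(z),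
1/d_ε(y) can each be replaced by α⁻¹ and the domain enlarged to ℝⁿ. -/
theorem abs_bistochOp_sub_le {ε α : ℝ} (hΩ : MeasurableSet Ω) (hs : IsShapeFunction h)
    (hd : IsRadiallyDecreasing h) (hε : 0 < ε) (hα : 0 < α)
    (hdeg : ∀ x ∈ Ω, α ≤ degreeFn Ω h ε x) (hfin : volume Ω ≠ ∞)
    {g : EuclideanSpace ℝ (Fin n) → ℝ} (hg : Continuous g) {M : ℝ} (hM : ∀ y, |g y| ≤ M)
    {x : EuclideanSpace ℝ (Fin n)} (hx : x ∈ Ω) :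
    |bistochOp Ω h ε g x - g x| ≤ (α * α * α)⁻¹ *
      ∫ z, radialKernel h ε x z * ∫ y, radialKernel h ε z y * |g y - g x| := by
  have : IsFiniteMeasure (volume.restrict Ω) := ⟨by simpa using hfin.lt_top⟩
  set ψ : EuclideanSpace ℝ (Fin n) → ℝ := fun y => |g y - g x| with hψ
  have hψc : Continuous ψ := (hg.sub continuous_const).abs
  have hψ0 : ∀ y, 0 ≤ ψ y := fun y => abs_nonneg _
  have hψM : ∀ y, |ψ y| ≤ M + M := fun y => by
    rw [hψ, abs_abs]
    exact (abs_sub _ _).trans (add_le_add (hM y) (hM x))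
  have hbdd : ∀ φ : EuclideanSpace ℝ (Fin n) → ℝ, Continuous φ → ∀ B : ℝ, (∀ y, |φ y| ≤ B) →
      MemLp φ ∞ (volume.restrict Ω) := fun φ hφ B hB =>
    memLp_top_of_bound hφ.aestronglyMeasurable B (Eventually.of_forall hB)
  have hgm := hbdd g hg M hM
  have hψm := hbdd ψ hψc _ hψM
  have hψi : IntegrableOn ψ Ω := hψm.integrable le_top
  have hcm : MemLp (fun _ : EuclideanSpace ℝ (Fin n) => g x) ∞ (volume.restrict Ω) :=
    hbdd _ continuous_const _ fun _ => hM x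
  have hkψ : ∀ z, Integrable fun y => radialKernel h ε z y * ψ y := fun z =>
    (integrable_radialKernel hs hε z).mul_bdd (c := M + M) hψc.aestronglyMeasurable
      (Eventually.of_forall hψM)
  have hUM : ∀ z, |∫ y, radialKernel h ε z y * ψ y| ≤ M + M := fun z => by
    have h1 := norm_integral_le_of_norm_le
      ((integrable_radialKernel hs hε z).mul_const (M + M))
      (f := fun y => radialKernel h ε z y * ψ y) (Eventually.of_forall fun y => by
        rw [norm_mul, Real.norm_of_nonneg (radialKernel_nonneg hs hε z y)]
        exact mul_le_mul_of_nonneg_left (hψM y) (radialKernel_nonneg hs hε z y))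
    rwa [integral_mul_const, integral_radialKernel hs hε, one_mul] at h1
  have hUc : Continuous fun z => ∫ y, radialKernel h ε z y * ψ y :=
    continuous_integral_radialKernel_mul hs hε hψc.aestronglyMeasurable hψM
  have hU0 : ∀ z, 0 ≤ ∫ y, radialKernel h ε z y * ψ y := fun z =>
    integral_nonneg fun y => mul_nonneg (radialKernel_nonneg hs hε z y) (hψ0 y)
  have h1 : bistochOp Ω h ε g x - g x = ∫ y in Ω, bistochKernel Ω h ε x y * (g y - g x) := by
    simp only [mul_sub]
    rw [integral_sub (integrableOn_bistochKernel_mul hΩ hs hd hε hα hdeg le_top hgm hx)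
      (integrableOn_bistochKernel_mul hΩ hs hd hε hα hdeg le_top hcm hx), integral_mul_const,
      integral_bistochKernel hΩ hs hd hε hα hdeg hx, one_mul]
    rfl
  have h2 : |bistochOp Ω h ε g x - g x| ≤ bistochOp Ω h ε ψ x := by
    rw [h1, ← Real.norm_eq_abs]
    refine norm_integral_le_of_norm_le
      (integrableOn_bistochKernel_mul hΩ hs hd hε hα hdeg le_top hψm hx) ?_
    filter_upwards [ae_restrict_mem hΩ] with y hy
    rw [norm_mul, Real.norm_of_nonneg (bistochKernel_nonneg hΩ hs hd hε hα hdeg hx hy),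
      Real.norm_eq_abs]
  have h3 : ∀ z, presmoothed Ω h ε ψ z ≤ (α * α)⁻¹ * ∫ y, radialKernel h ε z y * ψ y := by
    intro z
    refine (le_abs_self _).trans ((abs_presmoothed_le hΩ hs hd hε hα hdeg
      (integrableOn_radialKernel_mul_abs hs hd hε hψi z)).trans ?_)
    have h4 : ∫ y in Ω, radialKernel h ε z y * |ψ y| ≤ ∫ y, radialKernel h ε z y * ψ y := by
      simp only [abs_of_nonneg (hψ0 _)]
      exact setIntegral_le_integral (hkψ z)
        (Eventually.of_forall fun y => mul_nonneg (radialKernel_nonneg hs hε z y) (hψ0 y))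
    rw [← mul_assoc, ← mul_inv]
    gcongr
  obtain ⟨B, hB⟩ := exists_abs_presmoothed_le hΩ hs hd hε hα hdeg hψi
  have hk := integrable_radialKernel hs hε x
  have h5 : ∫ z, radialKernel h ε x z * presmoothed Ω h ε ψ z ≤ (α * α)⁻¹ *
      ∫ z, radialKernel h ε x z * ∫ y, radialKernel h ε z y * ψ y := by
    rw [← integral_const_mul]
    refine integral_mono (hk.mul_bdd (c := B)
      (aestronglyMeasurable_presmoothed hΩ hd hψi.1) (Eventually.of_forall hB))
      ((hk.mul_bdd (c := M + M) hUc.aestronglyMeasurable (Eventually.of_forall hUM)).const_mul _)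
      fun z => ?_
    simp only
    rw [mul_left_comm]
    exact mul_le_mul_of_nonneg_left (h3 z) (radialKernel_nonneg hs hε x z)
  refine h2.trans ?_
  rw [bistochOp_eq hΩ hs hd hε hα hdeg hfin hψi hx]
  have hT : 0 ≤ ∫ z, radialKernel h ε x z * ∫ y, radialKernel h ε z y * ψ y :=
    integral_nonneg fun z => mul_nonneg (radialKernel_nonneg hs hε x z) (hU0 z)
  calc (degreeFn Ω h ε x)⁻¹ * ∫ z, radialKernel h ε x z * presmoothed Ω h ε ψ z
      ≤ (degreeFn Ω h ε x)⁻¹ * ((α * α)⁻¹ *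
        ∫ z, radialKernel h ε x z * ∫ y, radialKernel h ε z y * ψ y) :=
        mul_le_mul_of_nonneg_left h5 (inv_nonneg.2 (degreeFn_pos_of_le hα hdeg hx).le)
    _ ≤ α⁻¹ * ((α * α)⁻¹ *
        ∫ z, radialKernel h ε x z * ∫ y, radialKernel h ε z y * ψ y) := by
        have := hdeg x hx
        gcongr
    _ = _ := by rw [← mul_assoc, ← mul_inv, mul_assoc α]

/-- On bounded continuous functions the bistochastic operators converge in `L^p`. -/
theorem tendsto_eLpNorm_bistochOp_sub_of_continuous {α ε₀ : ℝ} (hΩ : MeasurableSet Ω)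
    (hs : IsShapeFunction h) (hd : IsRadiallyDecreasing h) (hα : 0 < α) (hε₀ : 0 < ε₀)
    (hdeg : ∀ ε ∈ Ioo 0 ε₀, ∀ x ∈ Ω, α ≤ degreeFn Ω h ε x) (hfin : volume Ω ≠ ∞)
    {p : ℝ≥0∞} (hp : 1 ≤ p) (hp' : p ≠ ∞) {g : EuclideanSpace ℝ (Fin n) → ℝ}
    (hg : Continuous g) {M : ℝ} (hM : ∀ y, |g y| ≤ M) :
    Tendsto (fun ε => eLpNorm (bistochOp Ω h ε g - g) p (volume.restrict Ω)) (𝓝[>] 0) (𝓝 0) := by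
  have : IsFiniteMeasure (volume.restrict Ω) := ⟨by simpa using hfin.lt_top⟩
  have hp0 : p ≠ 0 := (one_pos.trans_le hp).ne'
  have hpos : 0 < p.toReal := ENNReal.toReal_pos hp0 hp'
  have hev : ∀ᶠ ε in 𝓝[>] (0 : ℝ), ε ∈ Ioo 0 ε₀ := Ioo_mem_nhdsGT hε₀
  have hM0 : 0 ≤ M := (abs_nonneg _).trans (hM 0)
  have hptw : ∀ x ∈ Ω, Tendsto (fun ε => bistochOp Ω h ε g x - g x) (𝓝[>] 0) (𝓝 0) := by
    intro x hx
    have h1 := (tendsto_integral_radialKernel_radialKernel hs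
      (ψ := fun y => |g y - g x|) (hg.sub continuous_const).abs (M := M + M) (fun y => by
        rw [abs_abs]
        exact (abs_sub _ _).trans (add_le_add (hM y) (hM x))) x).const_mul (α * α * α)⁻¹
    simp only [sub_self, abs_zero, mul_zero] at h1
    refine squeeze_zero_norm' ?_ h1
    filter_upwards [hev] with ε hε
    exact abs_bistochOp_sub_le hΩ hs hd hε.1 hα (hdeg ε hε) hfin hg hM hx
  have hgm : MemLp g ∞ (volume.restrict Ω) :=
    memLp_top_of_bound hg.aestronglyMeasurable M (Eventually.of_forall hM)
  -- The L^∞ contraction supplies a dominating constant independent of ε, integrable because Ω has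
  -- finite measure.
  have hbdd : ∀ ε ∈ Ioo 0 ε₀, ∀ᵐ x ∂(volume.restrict Ω),
      ‖bistochOp Ω h ε g x - g x‖ₑ ≤ ENNReal.ofReal M + ENNReal.ofReal M := by
    intro ε hε
    have h1 : eLpNorm g ∞ (volume.restrict Ω) ≤ ENNReal.ofReal M := by
      rw [eLpNorm_exponent_top]
      exact eLpNormEssSup_le_of_ae_bound (Eventually.of_forall hM)
    have h2 := (eLpNorm_bistochOp_le hΩ hs hd hε.1 hα (hdeg ε hε) le_top hgm.1).trans h1
    rw [eLpNorm_exponent_top] at h2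
    filter_upwards [enorm_ae_le_eLpNormEssSup (bistochOp Ω h ε g) (volume.restrict Ω)] with x hx
    refine enorm_sub_le.trans (add_le_add (hx.trans h2) ?_)
    rw [Real.enorm_eq_ofReal_abs]
    exact ENNReal.ofReal_le_ofReal (hM x)
  have hlin : Tendsto (fun ε => ∫⁻ x in Ω, ‖bistochOp Ω h ε g x - g x‖ₑ ^ p.toReal)
      (𝓝[>] 0) (𝓝 (∫⁻ _ in Ω, 0)) := by
    refine tendsto_lintegral_filter_of_dominated_convergence'
      (fun _ => (ENNReal.ofReal M + ENNReal.ofReal M) ^ p.toReal) ?_ ?_ ?_ ?_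
    · exact Eventually.of_forall fun ε =>
        ((aestronglyMeasurable_bistochOp hΩ hd hgm.1).sub hgm.1).enorm.pow_const _
    · filter_upwards [hev] with ε hε
      filter_upwards [hbdd ε hε] with x hx
      gcongr
    · rw [lintegral_const]
      exact ENNReal.mul_ne_top (ENNReal.rpow_ne_top_of_nonneg hpos.le (by simp))
        (measure_ne_top _ _)
    · filter_upwards [ae_restrict_mem hΩ] with x hx
      have h1 := ((hptw x hx).enorm).ennrpow_const p.toReal
      simpa [ENNReal.zero_rpow_of_pos hpos] using h1
  have h2 := hlin.ennrpow_const (1 / p.toReal)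
  rw [lintegral_zero, ENNReal.zero_rpow_of_pos (by positivity)] at h2
  refine h2.congr fun ε => ?_
  rw [eLpNorm_eq_lintegral_rpow_enorm_toReal hp0 hp']
  rfl

/-- The bistochastic operators converge strongly to the identity on `L^p`. -/
theorem tendsto_eLpNorm_bistochOp_sub {α ε₀ : ℝ} (hΩ : MeasurableSet Ω)
    (hs : IsShapeFunction h) (hd : IsRadiallyDecreasing h) (hα : 0 < α) (hε₀ : 0 < ε₀)
    (hdeg : ∀ ε ∈ Ioo 0 ε₀, ∀ x ∈ Ω, α ≤ degreeFn Ω h ε x) (hfin : volume Ω ≠ ∞)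
    {p : ℝ≥0∞} (hp : 1 ≤ p) (hp' : p ≠ ∞) {f : EuclideanSpace ℝ (Fin n) → ℝ}
    (hf : MemLp f p (volume.restrict Ω)) :
    Tendsto (fun ε => eLpNorm (bistochOp Ω h ε f - f) p (volume.restrict Ω)) (𝓝[>] 0) (𝓝 0) := by
  have : IsFiniteMeasure (volume.restrict Ω) := ⟨by simpa using hfin.lt_top⟩
  rw [ENNReal.tendsto_nhds_zero]
  intro η hη
  have hη3 : η / 3 ≠ 0 := by simp [ENNReal.div_eq_zero_iff, hη.ne']
  obtain ⟨g, hgc, hfg, hg, hgm⟩ := hf.exists_hasCompactSupport_eLpNorm_sub_le hp' hη3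
  obtain ⟨M, hM⟩ := hgc.exists_bound_of_continuous hg
  have hev : ∀ᶠ ε in 𝓝[>] (0 : ℝ), ε ∈ Ioo 0 ε₀ := Ioo_mem_nhdsGT hε₀
  have hlim := ENNReal.tendsto_nhds_zero.1 (tendsto_eLpNorm_bistochOp_sub_of_continuous hΩ hs hd
    hα hε₀ hdeg hfin hp hp' hg hM) _ (pos_iff_ne_zero.2 hη3)
  filter_upwards [hev, hlim] with ε hε hgε
  have hm : ∀ u : EuclideanSpace ℝ (Fin n) → ℝ, MemLp u p (volume.restrict Ω) →
      AEStronglyMeasurable (bistochOp Ω h ε u) (volume.restrict Ω) :=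
    fun u hu => aestronglyMeasurable_bistochOp hΩ hd hu.1
  -- Contraction bounds the first term by ‖f − g‖ uniformly in ε, so a single `g` serves all small
  -- ε.
  have hsplit : bistochOp Ω h ε f - f =ᵐ[volume.restrict Ω]
      bistochOp Ω h ε (f - g) + (bistochOp Ω h ε g - g) + (g - f) := by
    filter_upwards [ae_restrict_mem hΩ] with x hx
    have h1 : bistochOp Ω h ε (f - g) x = bistochOp Ω h ε f x - bistochOp Ω h ε g x := by
      simp only [bistochOp, Pi.sub_apply, mul_sub]
      exact integral_sub
        (integrableOn_bistochKernel_mul hΩ hs hd hε.1 hα (hdeg ε hε) hp hf hx)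
        (integrableOn_bistochKernel_mul hΩ hs hd hε.1 hα (hdeg ε hε) hp hgm hx)
    simp only [Pi.add_apply, Pi.sub_apply, h1]
    ring
  rw [eLpNorm_congr_ae hsplit]
  calc eLpNorm (bistochOp Ω h ε (f - g) + (bistochOp Ω h ε g - g) + (g - f)) p
        (volume.restrict Ω)
      ≤ eLpNorm (bistochOp Ω h ε (f - g)) p (volume.restrict Ω) +
          eLpNorm (bistochOp Ω h ε g - g) p (volume.restrict Ω) +
          eLpNorm (g - f) p (volume.restrict Ω) :=
        (eLpNorm_add_le ((hm _ (hf.sub hgm)).add ((hm g hgm).sub hgm.1)) (hgm.1.sub hf.1) hp).trans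
          (add_le_add_left (eLpNorm_add_le (hm _ (hf.sub hgm)) ((hm g hgm).sub hgm.1) hp) _)
    _ ≤ η / 3 + η / 3 + η / 3 := by
        refine add_le_add (add_le_add ?_ hgε) ?_
        · exact (eLpNorm_bistochOp_le hΩ hs hd hε.1 hα (hdeg ε hε) hp (hf.sub hgm).1).trans hfg
        · rwa [eLpNorm_sub_comm]
    _ = η := ENNReal.add_thirds η

end Convergence

/-! ### Boundedness, convergence and regularity of the operator family. -/

theorem theorem4p1 {n : ℕ} (Ω : Set (EuclideanSpace ℝ (Fin n))) (hΩ_open : IsOpen Ω)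
    (hΩ_thick : IsThick Ω) (h : EuclideanSpace ℝ (Fin n) → ℝ) (h_shape : IsShapeFunction h)
    (h_decr : IsRadiallyDecreasing h) :
    ∃ ε₀ > (0 : ℝ),
      -- the kernels are well defined for small `ε`
      (∀ ε ∈ Ioo 0 ε₀, ∀ x ∈ Ω, 0 < degreeFn Ω h ε x ∧ 0 < normalizationFn Ω h ε x ∧
        ∀ y ∈ Ω, IntegrableOn (bistochIntegrand Ω h ε x y) Ω volume) ∧
      -- uniformly bounded family of operators on every `L^p(Ω)`
      (∀ p : ℝ≥0∞, 1 ≤ p → ∃ A : ℝ≥0, ∀ ε ∈ Ioo 0 ε₀, ∀ f : EuclideanSpace ℝ (Fin n) → ℝ,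
        MemLp f p (volume.restrict Ω) →
          (∀ x ∈ Ω, IntegrableOn (fun y => bistochKernel Ω h ε x y * f y) Ω volume) ∧
          MemLp (bistochOp Ω h ε f) p (volume.restrict Ω) ∧
          eLpNorm (bistochOp Ω h ε f) p (volume.restrict Ω)
            ≤ A * eLpNorm f p (volume.restrict Ω)) ∧
      (Bornology.IsBounded Ω → HasDecayBound h →
        -- convergence in `L^p(Ω)`
        (∀ p : ℝ≥0∞, 1 < p → p < ∞ → ∀ f : EuclideanSpace ℝ (Fin n) → ℝ,
          MemLp f p (volume.restrict Ω) →
            Tendsto (fun ε => eLpNorm (bistochOp Ω h ε f - f) p (volume.restrict Ω))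
              (𝓝[>] 0) (𝓝 0)) ∧
        -- continuity and boundedness
        (∀ p q : ℝ≥0∞, 1 < p → ENNReal.HolderConjugate p q → MemLp h q volume →
          ∀ f : EuclideanSpace ℝ (Fin n) → ℝ, MemLp f p (volume.restrict Ω) →
            ∀ ε ∈ Ioo 0 ε₀, MemCb Ω (bistochOp Ω h ε f)) ∧
        -- differentiability
        (∀ r : ℕ, MemSobolevH r h →
          ∀ f : EuclideanSpace ℝ (Fin n) → ℝ, MemLp f 2 (volume.restrict Ω) →
            ∀ ε ∈ Ioo 0 ε₀, ContDiffOn ℝ r (bistochOp Ω h ε f) Ω)) := by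
  have hΩ := hΩ_open.measurableSet
  obtain ⟨α, hα, ε₀, hε₀, hdeg⟩ := exists_le_degreeFn hΩ hΩ_thick h_shape h_decr
  refine ⟨ε₀, hε₀, fun ε hε x hx => ?_, fun p hp => ⟨1, fun ε hε f hf => ?_⟩,
    fun hbdd _ => ?_⟩
  · exact ⟨degreeFn_pos_of_le hα (hdeg ε hε) hx,
      hα.trans_le (le_normalizationFn hΩ h_shape h_decr hε.1 hα (hdeg ε hε) hx),
      fun y hy => integrableOn_bistochIntegrand hΩ h_shape h_decr hε.1 hα (hdeg ε hε) hx hy⟩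
  · refine ⟨fun x hx => integrableOn_bistochKernel_mul hΩ h_shape h_decr hε.1 hα (hdeg ε hε) hp hf
      hx, memLp_bistochOp hΩ h_shape h_decr hε.1 hα (hdeg ε hε) hp hf, ?_⟩
    rw [ENNReal.coe_one, one_mul]
    exact eLpNorm_bistochOp_le hΩ h_shape h_decr hε.1 hα (hdeg ε hε) hp hf.1
  · have hfin : volume Ω ≠ ∞ := hbdd.measure_lt_top.ne
    have : IsFiniteMeasure (volume.restrict Ω) := ⟨by simpa using hfin.lt_top⟩
    refine ⟨fun p hp hp' f hf => ?_, fun p q hp _ _ f hf ε hε => ?_, fun r hr f hf ε hε => ?_⟩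
    · exact tendsto_eLpNorm_bistochOp_sub hΩ h_shape h_decr hα hε₀ hdeg hfin hp.le hp'.ne hf
    -- Finite measure embeds L^p(Ω) in L¹(Ω), where the factorization and the kernel bound apply.
    · have hfi : IntegrableOn f Ω := hf.integrable hp.le
      exact ⟨continuousOn_bistochOp hΩ h_shape h_decr hε.1 hα (hdeg ε hε) hfin hfi, _,
        fun x hx => abs_bistochOp_le hΩ h_shape h_decr hε.1 hα (hdeg ε hε) hfi hx⟩
    · exact contDiffOn_bistochOp hΩ h_shape h_decr hε.1 hα (hdeg ε hε) hfin hr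
        (hf.integrable (by norm_num))
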